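/- \textbf{Notation.} For a function $f$ put $\overline{f}(z):=\overline{f(\overline z)}$. All powers and logarithms of complex numbers are principal. Riemann's auxiliary function is $$\mathcal R(s)=\int_{0\swarrow 1}\frac{x^{-s}e^{\pi i x^2}}{e^{\pi i x}-e^{-\pi i x}}\,dx,$$ the integral being along a straight line of direction $e^{-3\pi i/4}$ (from upper right to lower left) that crosses the real axis between $0$ and $1$. Let $$g(\tau,z)=\exp\Bigl\{-\frac{i}{8\tau^2}\log(1+2i\tau z)-\frac{z}{4\tau}+i\frac{z^2}{4}\Bigr\}=\sum_{k\ge0}P_k(z)\tau^k\qquad(2|\tau z|<1)$$ (the singularity at $\tau=0$ is removable, with value $1$), and for $k\ge 0$, $q\in\mathbb C$ let $$D_k(q)=\Bigl(-\frac1{4\sqrt\pi}\Bigr)^k\int_{0\swarrow}\frac{e^{\frac{\pi i}{2}(v-q)^2}}{2\cos\frac{\pi v}{2}}\,P_k\bigl(i\sqrt\pi(v-q)\bigr)\,dv,$$ the integral being along the straight line of direction $e^{-3\pi i/4}$ through $0$. For $0<\theta<\pi$ let $$\Delta_\theta=\{z\in\mathbb C:\ -\pi+\theta\le\arg z\le\pi-\theta,\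 |z|\ge2\pi\}.$$ For $s$ with $1-s\in\Delta_\theta$ let $\eta=\eta_1+i\eta_2$ be the square root $\eta=\sqrt{(s-1)/2\pi i}$ with $-\frac{\pi}{4}<\arg\eta<\frac{3\pi}{4}$, and put $$m=\lfloor\eta_1+\eta_2\rfloor,\qquad p=2\eta-2m-1,\qquad \mu=\frac{\operatorname{Re}\overline p+\operatorname{Im}\overline p}{\sqrt2}=\frac{\operatorname{Re}p-\operatorname{Im}p}{\sqrt2}.$$ \textbf{Theorem.} Let $0<\theta<\pi$ and let $K\ge1$ be an integer. Then for all $s$ with $1-s\in\Delta_\theta$, $$\overline{\mathcal R}(1-s)=\sum_{n=1}^m n^{s-1}-\frac{(-1)^m}{2i}\,\eta^{s-1}e^{-\pi i\eta^2}\Bigl\{\sum_{k=0}^K\frac{\overline D_k(p)}{\eta^k}+O_{K,\theta}\bigl(e^{-\frac{\pi}{2\sqrt2}|\mu|}|\eta|^{-K-1}\bigr)\Bigr\},$$ where the constant implied by $O_{K,\theta}$ depends only on $K$ and $\theta$. -/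

import Mathlib

open Complex

noncomputable section

namespace RiemannAux

/-- The integral of `f` along the straight line through `c` of direction `e^{-3πi/4} = -e^{πi/4}`,
that is, coming from infinity in the upper right and going to infinity in the lower left. -/
def lineIntegral (c : ℂ) (f : ℂ → ℂ) : ℂ :=
  ∫ u : ℝ, f (c + (u : ℂ) * exp (-(3 * (Real.pi : ℂ) / 4) * I)) *
    exp (-(3 * (Real.pi : ℂ) / 4) * I)

/-- Riemann's auxiliary function. The line crosses the real axis between `0` and `1`
(here at `1/2`); the power `x ^ (-s)` is taken with the principal logarithm. -/
def auxR (s : ℂ) : ℂ :=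
  lineIntegral (1 / 2) fun x =>
    x ^ (-s) * exp ((Real.pi : ℂ) * I * x ^ 2) /
      (exp ((Real.pi : ℂ) * I * x) - exp (-((Real.pi : ℂ) * I * x)))

/-- The conjugate function `f̄(z) = conj (f (conj z))`. -/
def conjFun (f : ℂ → ℂ) (z : ℂ) : ℂ :=
  (starRingEnd ℂ) (f ((starRingEnd ℂ) z))

/-- The function `g(τ, z)`; at `τ = 0` it has a removable singularity with value `1`. -/
def g (τ z : ℂ) : ℂ :=
  if τ = 0 then 1
  else exp (-(I / (8 * τ ^ 2)) * log (1 + 2 * I * τ * z) - z / (4 * τ) + I * z ^ 2 / 4)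

/-- `P k z` is the coefficient of `τ ^ k` in the Taylor series at `τ = 0` of `τ ↦ g τ z`. -/
def P (k : ℕ) (z : ℂ) : ℂ :=
  iteratedDeriv k (fun τ : ℂ => g τ z) 0 / (k.factorial : ℂ)

/-- The coefficients of the expansion; the line of integration passes through `0`. -/
def D (k : ℕ) (q : ℂ) : ℂ :=
  (-(1 / (4 * (Real.sqrt Real.pi : ℂ)))) ^ k *
    lineIntegral 0 fun v =>
      exp ((Real.pi : ℂ) * I / 2 * (v - q) ^ 2) / (2 * cos ((Real.pi : ℂ) * v / 2)) *
        P k (I * (Real.sqrt Real.pi : ℂ) * (v - q))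

/-- The real number `μ` in the decomposition `q = (μ + iν) e^{πi/4}`. -/
def mu (q : ℂ) : ℝ := (q.re + q.im) / Real.sqrt 2

/-- The closed region `Δ_θ`. -/
def Delta (θ : ℝ) : Set ℂ :=
  {s | -Real.pi + θ ≤ arg s ∧ arg s ≤ Real.pi - θ ∧ 2 * Real.pi ≤ ‖s‖}

/-- The square root `η` of `(s - 1) / (2πi)` with `-π/4 < arg η < 3π/4`, for `1 - s` not in
`(-∞, 0]`; see `eta_sq` and `eta_arg`. -/
def eta (s : ℂ) : ℂ :=
  exp ((log ((1 - s) / (2 * (Real.pi : ℂ))) + (Real.pi : ℂ) / 2 * I) / 2)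

theorem eta_sq (s : ℂ) (hs : s ≠ 1) : eta s ^ 2 = (s - 1) / (2 * (Real.pi : ℂ) * I) := by
  have hpi : (Real.pi : ℂ) ≠ 0 := by exact_mod_cast Real.pi_ne_zero
  have h1 : (1 - s) / (2 * (Real.pi : ℂ)) ≠ 0 :=
    div_ne_zero (sub_ne_zero.2 hs.symm) (mul_ne_zero two_ne_zero hpi)
  rw [eta, ← exp_nat_mul]
  have : ((2 : ℕ) : ℂ) * ((log ((1 - s) / (2 * (Real.pi : ℂ))) + (Real.pi : ℂ) / 2 * I) / 2)
      = log ((1 - s) / (2 * (Real.pi : ℂ))) + (Real.pi : ℂ) / 2 * I := by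
    push_cast; ring
  rw [this, exp_add, exp_log h1, exp_pi_div_two_mul_I]
  field_simp
  rw [I_sq]; ring

theorem eta_arg (s : ℂ) (hs : arg (1 - s) < Real.pi) :
    -(Real.pi / 4) < arg (eta s) ∧ arg (eta s) < 3 * Real.pi / 4 := by
  have hpi := Real.pi_pos
  have h0 : arg ((1 - s) / (2 * (Real.pi : ℂ))) = arg (1 - s) := by
    have : (1 - s) / (2 * (Real.pi : ℂ)) = ((1 / (2 * Real.pi) : ℝ) : ℂ) * (1 - s) := by
      push_cast; ring
    rw [this, arg_real_mul _ (by positivity)]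
  have him : ((log ((1 - s) / (2 * (Real.pi : ℂ))) + (Real.pi : ℂ) / 2 * I) / 2).im
      = (arg (1 - s) + Real.pi / 2) / 2 := by
    simp [log_im, h0]
  have hlow := neg_pi_lt_arg (1 - s)
  have harg : arg (eta s) = (arg (1 - s) + Real.pi / 2) / 2 := by
    rw [eta, arg_exp, him]
    rw [toIocMod_eq_self]
    constructor <;> linarith
  rw [harg]
  constructor <;> linarith

/-- `m = ⌊η₁ + η₂⌋`; here `η₁ + η₂ ≥ 0` because `-π/4 < arg η < 3π/4`. -/
def m (s : ℂ) : ℕ := ⌊(eta s).re + (eta s).im⌋₊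

/-- `p = -2 (m + 1/2 - η)`. -/
def p (s : ℂ) : ℂ := -2 * ((m s : ℂ) + 1 / 2 - eta s)

end RiemannAux

end

/-!
The statement is a saddle point expansion, proved in conjugated form: with `a = conj (eta s)`,
`w = conj (1 - s) = 2πi a²` and `q = conj (p s) = 2a - 2m - 1` it describes `auxR w`.

The integrand `x ^ (-w) e^{πi x²} / (e^{πi x} - e^{-πi x})` has poles at the positive integers.
Moving the line of integration from `1/2` to `m + 1/2` collects the residues `n ^ (-w)`
(`auxR_eq_sum_add`, resting on the residue formula `strip_residue`). The new line passes close to the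
saddle point `a` of `x ^ (-w) e^{πi x²}`, and the substitution `x = m + 1/2 + v/2` turns the
integral into that of `e^{πi (v - q)² / 2} g(τ, z) / (2 cos (πv/2))` with `τ = -1 / (4 √π a)` and
`z = i √π (v - q)` (`lineIntegral_kernel_eq`). The Taylor expansion of `g` in powers of `τ` yields the
terms `D k q / a ^ k`, and the remainder has to be estimated.

* The line is parametrised so that `v - q = dir * V` with `|Im V| ≤ 1` and `Re V = u + mu q`. The
  factor `1 / cos (πv/2)` is `O(e^{-π|u|/(2√2)})` (`exp_le_norm_two_cos`), and `|u| ≥ |mu q| - |Re V|`.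
  This produces the factor `e^{-π|mu q|/(2√2)}` at the cost of `e^{π|Re V|/(2√2)}`, which a Gaussian
  in `Re V` absorbs. So it suffices to bound the Taylor remainder times `e^{πi (v - q)² / 2}` by
  `|a|^{-n}` times such a Gaussian (`exists_gaussRem_bound`).
* If `|z|` is small compared with `|a|`, this is Cauchy's estimate (`norm_g_sub_sum_le`).
* Otherwise the Taylor polynomial and the function are bounded separately. With
  `ζ = (v - q) / (2a)`, the function is `exp ((π/2) V² phase ζ)`. The real part of `phase` is
  negative off the real axis (`phase_re_neg`), hence, by compactness, bounded away from `0` in closed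
  sectors avoiding it (`exists_phase_bound`); the hypothesis on `arg (1 - s)` puts `ζ` into such a
  sector as soon as `|V|` is large. For bounded `V` the modulus of `a` is bounded too, and the distance
  of the line from the origin gives a trivial bound.
-/

namespace RiemannAux

/-! ### The sign of the real part of the phase -/

/-- The exponent `log (1 + ζ) - ζ - ζ² / 2` divided by `ζ²`. -/
noncomputable def phase (ζ : ℂ) : ℂ := (log (1 + ζ) - ζ - ζ ^ 2 / 2) / ζ ^ 2

/-- The inequality `Re (conj ζ² (log (1 + ζ) - ζ - ζ² / 2)) < 0` for `ζ = a + i b` with `b > 0`,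
where `l = log |1 + ζ|` and `α = arg (1 + ζ)`. Besides `1 - 1 / t ≤ log t ≤ t - 1` only
`sin α ≤ α ≤ tan α` is used, in the form of the last two hypotheses. -/
theorem real_phase_ineq (a b l α : ℝ) (hb : 0 < b)
    (hl : l ≤ (2 * a + (a ^ 2 + b ^ 2)) / 2)
    (hl' : (2 * a + (a ^ 2 + b ^ 2)) / 2 ≤ l * ((1 + a) ^ 2 + b ^ 2))
    (hα : 0 < α) (hα₁ : 0 ≤ a → α * (1 + a) ≤ b)
    (hα₂ : (1 + a) ^ 2 + b ^ 2 ≤ 1 → b ≤ α) :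
    (a ^ 2 - b ^ 2) * l + 2 * a * b * α - (a ^ 2 + b ^ 2) * a - (a ^ 2 + b ^ 2) ^ 2 / 2 < 0 := by
  have hb2 : 0 < b ^ 2 := by positivity
  have hn : 0 < a ^ 2 + b ^ 2 := by positivity
  have hu : 0 < (1 + a) ^ 2 + b ^ 2 := by positivity
  rcases le_or_gt 0 a with ha | ha
  · have h1 := hα₁ ha
    rcases le_or_gt (b ^ 2) (a ^ 2) with hab | hab
    · have h2 := mul_le_mul_of_nonneg_left hl (sub_nonneg.2 hab)
      have h3 : α ≤ b := by nlinarith [mul_nonneg hα.le ha]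
      have h4 : a * b * α ≤ a * b * b := mul_le_mul_of_nonneg_left h3 (by positivity)
      nlinarith [mul_pos hb2 hn]
    · have h2 := mul_le_mul_of_nonneg_left hl' (sub_nonneg.2 hab.le)
      have h4 : a * b * (α * (1 + a)) ≤ a * b * b := mul_le_mul_of_nonneg_left h1 (by positivity)
      set u := (1 + a) ^ 2 + b ^ 2 with hu'
      set T := (a ^ 2 - b ^ 2) * l + 2 * a * b * α - (a ^ 2 + b ^ 2) * a - (a ^ 2 + b ^ 2) ^ 2 / 2
        with hT
      have key : T * (u * (1 + a)) < 0 := by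
        have e1 : T * (u * (1 + a)) = -((b ^ 2 - a ^ 2) * (l * u)) * (1 + a)
            + 2 * (a * b * (α * (1 + a))) * u
            - (a ^ 2 + b ^ 2) * (2 * a + (a ^ 2 + b ^ 2)) / 2 * u * (1 + a) := by
          rw [hT]; ring
        have h5 := mul_le_mul_of_nonneg_right h2 (by linarith : 0 ≤ 1 + a)
        have h6 := mul_le_mul_of_nonneg_right h4 hu.le
        have h7 : 2 * (a * b * b) * u < (b ^ 2 - a ^ 2) * ((2 * a + (a ^ 2 + b ^ 2)) / 2) * (1 + a)
            + (a ^ 2 + b ^ 2) * (2 * a + (a ^ 2 + b ^ 2)) / 2 * u * (1 + a) := by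
          rw [hu', ← sub_pos]
          ring_nf
          positivity
        linarith
      by_contra hcon
      push Not at hcon
      have : 0 ≤ T * (u * (1 + a)) := mul_nonneg hcon (by positivity)
      linarith
  · have hab2 : 2 * a * b * α < 0 := by
      have : 0 < (-a) * b * α := by have := neg_pos.2 ha; positivity
      linarith
    rcases le_or_gt (b ^ 2) (a ^ 2) with hab | hab
    · have h2 := mul_le_mul_of_nonneg_left hl (sub_nonneg.2 hab)
      rcases le_or_gt 0 (2 * a + (a ^ 2 + b ^ 2)) with h0 | h0
      · nlinarith [mul_nonneg hb2.le h0]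
      · have h3 := hα₂ (by nlinarith)
        have h4 : (-a) * b * b ≤ (-a) * b * α :=
          mul_le_mul_of_nonneg_left h3 (by have := neg_pos.2 ha; positivity)
        nlinarith [mul_pos hb2 hn]
    · rcases le_or_gt 0 (2 * a + (a ^ 2 + b ^ 2)) with h0 | h0
      · have hl0 : 0 ≤ l := by
          by_contra hcon
          push Not at hcon
          nlinarith
        nlinarith [mul_nonneg (sub_nonneg.2 hab.le) hl0, mul_nonneg hn.le h0]
      · have h3 := hα₂ (by nlinarith)
        have h4 : (-a) * b * b ≤ (-a) * b * α :=
          mul_le_mul_of_nonneg_left h3 (by have := neg_pos.2 ha; positivity)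
        have h2 := mul_le_mul_of_nonneg_left hl' (sub_nonneg.2 hab.le)
        set u := (1 + a) ^ 2 + b ^ 2 with hu'
        set T := (a ^ 2 - b ^ 2) * l + 2 * a * b * α - (a ^ 2 + b ^ 2) * a - (a ^ 2 + b ^ 2) ^ 2 / 2
          with hT
        have h5 := mul_le_mul_of_nonneg_right h4 hu.le
        -- With `e = 2A - n` the claim becomes positivity of a quadratic polynomial in `e`, whose discriminant
        -- is negative because `4 A² b² ≤ n²`.
        obtain ⟨A, rfl⟩ : ∃ A, a = -A := ⟨-a, by ring⟩
        set n := (-A) ^ 2 + b ^ 2 with hn'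
        have h6 : 0 < n * (2 * A - n) ^ 2 - 4 * A * b ^ 2 * (2 * A - n) + 2 * b ^ 2 * n := by
          have e1 : n * (n * (2 * A - n) ^ 2 - 4 * A * b ^ 2 * (2 * A - n) + 2 * b ^ 2 * n)
            = (n * (2 * A - n) - 2 * A * b ^ 2) ^ 2 + 2 * b ^ 2 * (A ^ 4 + b ^ 4) := by
            rw [hn']; ring
          have e2 : 0 < n * (n * (2 * A - n) ^ 2 - 4 * A * b ^ 2 * (2 * A - n) + 2 * b ^ 2 * n) := by
            rw [e1]; positivity
          exact (pos_iff_pos_of_mul_pos e2).1 hn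
        have key : T * (2 * u) < 0 := by
          have e1 : T * (2 * u) = -2 * ((b ^ 2 - (-A) ^ 2) * (l * u))
              - 4 * (A * b * α * u) + n * (2 * A - n) * u := by
            rw [hT]; ring
          have e2 : -2 * ((b ^ 2 - (-A) ^ 2) * ((2 * (-A) + n) / 2)) - 4 * (A * b * b * u)
              + n * (2 * A - n) * u =
              -(n * (2 * A - n) ^ 2 - 4 * A * b ^ 2 * (2 * A - n) + 2 * b ^ 2 * n) := by
            rw [hu', hn']; ring
          nlinarith
        by_contra hcon
        push Not at hcon
        have : 0 ≤ T * (2 * u) := mul_nonneg hcon (by positivity)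
        linarith

theorem phase_re_neg_of_im_pos {ζ : ℂ} (h : 0 < ζ.im) : (phase ζ).re < 0 := by
  set a := ζ.re with ha
  set b := ζ.im with hb
  have hζ : ζ = (a : ℂ) + b * I := by rw [ha, hb, re_add_im]
  have hre : (1 + ζ).re = 1 + a := by simp [ha]
  have him : (1 + ζ).im = b := by simp [hb]
  set u := (1 + a) ^ 2 + b ^ 2 with hu
  have hu0 : 0 < u := by positivity
  have hnorm : ‖1 + ζ‖ ^ 2 = u := by
    rw [← normSq_eq_norm_sq, normSq_apply, hre, him, hu]; ring
  have hnz : 1 + ζ ≠ 0 := fun h0 => by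
    rw [h0] at him; simp at him; linarith
  have hnpos : 0 < ‖1 + ζ‖ := norm_pos_iff.2 hnz
  set l := Real.log ‖1 + ζ‖ with hl
  set α := arg (1 + ζ) with hα
  have hlu : 2 * l = Real.log u := by rw [← hnorm, Real.log_pow]; push_cast; ring
  have hlog : log (1 + ζ) = (l : ℂ) + α * I := by
    rw [← re_add_im (log (1 + ζ)), log_re, log_im]
  have hα0 : 0 ≤ α := arg_nonneg_iff.2 (by rw [him]; exact h.le)
  have hsin : Real.sin α * ‖1 + ζ‖ = b := by rw [mul_comm, norm_mul_sin_arg, him]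
  have hα1 : 0 < α := by
    rcases hα0.lt_or_eq with h1 | h1
    · exact h1
    · rw [← h1] at hsin; simp at hsin; linarith
  have hup := Real.log_le_sub_one_of_pos hu0
  have hlow := Real.one_sub_inv_le_log_of_pos hu0
  have key := real_phase_ineq a b l α h (by nlinarith) (by
      have : (1 - u⁻¹) * u ≤ Real.log u * u := mul_le_mul_of_nonneg_right hlow hu0.le
      rw [sub_mul, inv_mul_cancel₀ hu0.ne'] at this
      rw [← hlu] at this
      nlinarith) hα1
    (by
      intro h0
      have h1 : 0 < (1 + ζ).re := by rw [hre]; linarith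
      have h2 : α < Real.pi / 2 := by
        have := abs_arg_lt_pi_div_two_iff.2 (Or.inl h1)
        exact (abs_lt.1 this).2
      have h3 := Real.le_tan hα0 h2
      rw [hα, tan_arg, him, hre, le_div_iff₀ (by linarith)] at h3
      exact h3)
    (by
      intro h0
      have h1 : ‖1 + ζ‖ ≤ 1 := by
        rw [← sq_le_one_iff₀ hnpos.le, hnorm]; exact h0
      have h2 := Real.sin_lt hα1
      have h3 : 0 ≤ Real.sin α := Real.sin_nonneg_of_nonneg_of_le_pi hα0 (arg_le_pi _)
      nlinarith)
  have hn : 0 < a ^ 2 + b ^ 2 := by positivity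
  have hζ0 : ζ ≠ 0 := fun h0 => by rw [h0] at hb; simp at hb; linarith
  have hconj : ζ * (starRingEnd ℂ) ζ = ((a ^ 2 + b ^ 2 : ℝ) : ℂ) := by
    rw [mul_conj, normSq_apply]; congr 1; rw [← ha, ← hb]; ring
  have hmul : phase ζ * ((a ^ 2 + b ^ 2 : ℝ) : ℂ) ^ 2 =
      (log (1 + ζ) - ζ - ζ ^ 2 / 2) * (starRingEnd ℂ) ζ ^ 2 := by
    rw [← hconj, phase]; field_simp
  have hcz : (starRingEnd ℂ) ζ = (a : ℂ) - b * I := by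
    rw [hζ]; simp [sub_eq_add_neg]
  have hre2 : (phase ζ).re * (a ^ 2 + b ^ 2) ^ 2 =
      (a ^ 2 - b ^ 2) * l + 2 * a * b * α - (a ^ 2 + b ^ 2) * a - (a ^ 2 + b ^ 2) ^ 2 / 2 := by
    have h1 := congrArg re hmul
    rw [← ofReal_pow, re_mul_ofReal] at h1
    rw [h1, hlog, hcz, hζ]
    have e : ((l : ℂ) + α * I - ((a : ℂ) + b * I) - ((a : ℂ) + b * I) ^ 2 / 2)
        * ((a : ℂ) - b * I) ^ 2 =
        (((a ^ 2 - b ^ 2) * l + 2 * a * b * α - (a ^ 2 + b ^ 2) * a - (a ^ 2 + b ^ 2) ^ 2 / 2 : ℝ) : ℂ)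
        + (((a ^ 2 - b ^ 2) * α - 2 * a * b * l + (a ^ 2 + b ^ 2) * b : ℝ) : ℂ) * I := by
      push_cast
      linear_combination ((-2 * (a : ℂ) * b * α + b ^ 2 * l + b ^ 2 * α * I - a * b ^ 2
        + (a : ℂ) ^ 2 * b ^ 2) - I * b ^ 3 + 2 * a * b ^ 2 + b ^ 4 / 2 * (1 - I ^ 2)) * I_sq
    rw [e]
    simp only [add_re, ofReal_re, re_ofReal_mul, I_re, mul_zero, add_zero]
  have : (phase ζ).re * (a ^ 2 + b ^ 2) ^ 2 < 0 := by rw [hre2]; exact key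
  by_contra hcon
  push Not at hcon
  have : 0 ≤ (phase ζ).re * (a ^ 2 + b ^ 2) ^ 2 := mul_nonneg hcon (by positivity)
  linarith

theorem phase_conj {ζ : ℂ} (h : ζ.im ≠ 0) :
    phase ((starRingEnd ℂ) ζ) = (starRingEnd ℂ) (phase ζ) := by
  have : log (1 + (starRingEnd ℂ) ζ) = (starRingEnd ℂ) (log (1 + ζ)) := by
    rw [← log_conj]
    · simp
    · intro h0
      rw [arg_eq_pi_iff] at h0
      apply h; simpa using h0.2
  simp [phase, this, map_ofNat]

theorem phase_re_neg {ζ : ℂ} (h : ζ.im ≠ 0) : (phase ζ).re < 0 := by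
  rcases h.lt_or_gt with h1 | h1
  · have := phase_re_neg_of_im_pos (ζ := (starRingEnd ℂ) ζ) (by simpa using h1)
    rwa [phase_conj h, conj_re] at this
  · exact phase_re_neg_of_im_pos h1

theorem norm_log_le (w : ℂ) : ‖log w‖ ≤ ‖w‖ + ‖w‖⁻¹ + 4 := by
  have h1 : ‖log w‖ ≤ |Real.log ‖w‖| + |arg w| := by
    have := norm_le_abs_re_add_abs_im (log w)
    rwa [log_re, log_im] at this
  have h2 : |arg w| ≤ 4 := (abs_arg_le_pi w).trans (by linarith [Real.pi_lt_d2])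
  have h3 : |Real.log ‖w‖| ≤ ‖w‖ + ‖w‖⁻¹ := by
    rcases (norm_nonneg w).eq_or_lt with h0 | h0
    · rw [← h0]; simp
    · have := Real.log_le_sub_one_of_pos h0
      have := Real.one_sub_inv_le_log_of_pos h0
      have := inv_pos.2 h0
      rw [abs_le]; constructor <;> linarith
  linarith

/-- At infinity `phase` tends to `-1 / 2`. -/
theorem norm_phase_add_half_le {ζ : ℂ} (h : 20 ≤ ‖ζ‖) : ‖phase ζ + 1 / 2‖ ≤ 1 / 4 := by
  have h0 : ζ ≠ 0 := norm_pos_iff.1 (by linarith)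
  have e : phase ζ + 1 / 2 = (log (1 + ζ) - ζ) / ζ ^ 2 := by
    rw [phase]; field_simp; ring
  rw [e, norm_div, norm_pow, div_le_iff₀ (by positivity)]
  have h1 : ‖1 + ζ‖ ≤ 1 + ‖ζ‖ := (norm_add_le _ _).trans (by simp)
  have h2 : 1 ≤ ‖1 + ζ‖ := by
    have := norm_sub_le (1 + ζ) 1
    simp at this
    linarith
  have h3 : ‖1 + ζ‖⁻¹ ≤ 1 := inv_le_one_of_one_le₀ h2
  have h4 := norm_log_le (1 + ζ)
  have h5 := norm_sub_le (log (1 + ζ)) ζ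
  nlinarith

/-- In a closed sector avoiding the real axis, and away from the origin, the real part of `phase` is
bounded away from `0`. At the point `-2` of the real axis, which corresponds to the
second saddle point, the real part vanishes. -/
theorem exists_phase_bound {δ : ℝ} (hδ : 0 < δ) :
    ∃ c > 0, ∃ C > 0, ∀ ζ : ℂ, δ * ‖ζ‖ ≤ |ζ.im| → 1 / 8 ≤ ‖ζ‖ →
      (phase ζ).re ≤ -c ∧ ‖phase ζ‖ ≤ C := by
  set S : Set ℂ := Metric.closedBall 0 20 ∩ {ζ | δ * ‖ζ‖ ≤ |ζ.im| ∧ 1 / 8 ≤ ‖ζ‖} with hS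
  have hSc : IsCompact S := by
    apply (isCompact_closedBall (0 : ℂ) 20).inter_right
    change IsClosed ({ζ : ℂ | δ * ‖ζ‖ ≤ |ζ.im|} ∩ {ζ : ℂ | 1 / 8 ≤ ‖ζ‖})
    exact (isClosed_le (by fun_prop) continuous_im.abs).inter
      (isClosed_le continuous_const continuous_norm)
  have him : ∀ ζ ∈ S, ζ.im ≠ 0 := by
    rintro ζ ⟨-, h1, h2⟩ h0
    rw [h0, abs_zero] at h1
    nlinarith
  have hcont : ContinuousOn phase S := by
    intro ζ hζ
    have h0 : ζ ≠ 0 := fun h => him ζ hζ (by simp [h])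
    have h1 : 1 + ζ ∈ slitPlane := Or.inr (by simpa using him ζ hζ)
    apply ContinuousAt.continuousWithinAt
    have h2 : ContinuousAt (fun x : ℂ => log (1 + x)) ζ :=
      ContinuousAt.clog (by fun_prop) h1
    exact ContinuousAt.div (f := fun x : ℂ => log (1 + x) - x - x ^ 2 / 2)
      (g := fun x : ℂ => x ^ 2) (by fun_prop) (by fun_prop) (pow_ne_zero _ h0)
  obtain ⟨c, hc, hc'⟩ : ∃ c > 0, ∀ ζ ∈ S, (phase ζ).re ≤ -c := by
    rcases S.eq_empty_or_nonempty with he | hne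
    · exact ⟨1, one_pos, by simp [he]⟩
    · obtain ⟨x, hx, hmax⟩ := hSc.exists_isMaxOn hne (continuous_re.comp_continuousOn hcont)
      exact ⟨-(phase x).re, by linarith [phase_re_neg (him x hx)], fun ζ hζ => by
        simpa using hmax hζ⟩
  obtain ⟨C, hC⟩ := hSc.exists_bound_of_continuousOn hcont
  refine ⟨min c (1 / 4), by positivity, max C 1, by positivity, fun ζ h1 h2 => ?_⟩
  rcases le_or_gt ‖ζ‖ 20 with h3 | h3
  · have hζ : ζ ∈ S := ⟨by simpa using h3, h1, h2⟩
    exact ⟨(hc' ζ hζ).trans (neg_le_neg (min_le_left _ _)), (hC ζ hζ).trans (le_max_left _ _)⟩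
  · have h4 := norm_phase_add_half_le h3.le
    constructor
    · have h5 := (abs_le.1 ((abs_re_le_norm _).trans h4)).2
      have h6 : (phase ζ + 1 / 2).re = (phase ζ).re + 1 / 2 := by simp
      rw [h6] at h5
      have := min_le_right c (1 / 4 : ℝ)
      linarith
    · have h5 := norm_sub_le (phase ζ + 1 / 2) (1 / 2)
      have h6 : ‖(1 / 2 : ℂ)‖ = 1 / 2 := by simp
      rw [add_sub_cancel_right, h6] at h5
      exact le_trans (by linarith) (le_max_right C 1)

/-! ### The Taylor coefficients of the generating function -/

theorem norm_log_one_add_sub_le {ζ : ℂ} (h : ‖ζ‖ ≤ 1 / 2) :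
    ‖log (1 + ζ) - ζ + ζ ^ 2 / 2‖ ≤ ‖ζ‖ ^ 3 * (2 / 3) := by
  have h1 := norm_log_sub_logTaylor_le 2 (z := ζ) (by linarith)
  have e : logTaylor (2 + 1) ζ = ζ - ζ ^ 2 / 2 := by
    simp [logTaylor, Finset.sum_range_succ]; ring
  rw [e, ← sub_add] at h1
  refine h1.trans ?_
  have h2 : (1 - ‖ζ‖)⁻¹ ≤ 2 := by
    rw [inv_le_comm₀ (by linarith) (by norm_num)]; linarith
  have h3 : ‖ζ‖ ^ (2 + 1) * (1 - ‖ζ‖)⁻¹ ≤ ‖ζ‖ ^ 3 * 2 :=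
    mul_le_mul_of_nonneg_left h2 (by positivity)
  push_cast
  linarith

theorem g_eq_exp {τ : ℂ} (hτ : τ ≠ 0) (z : ℂ) :
    g τ z = exp (-(I / (8 * τ ^ 2)) *
      (log (1 + 2 * I * τ * z) - 2 * I * τ * z + (2 * I * τ * z) ^ 2 / 2)) := by
  rw [g, if_neg hτ]
  congr 1
  field_simp
  linear_combination (-8 * τ * z + 8 * I * τ ^ 2 * z ^ 2) * I_sq

/-- The exponent of `g` is small compared with `|z|²` on the disc in which Cauchy's estimate is
applied. -/
theorem exists_g_eq_exp {τ z : ℂ} (h : 4 * (‖τ‖ * ‖z‖) ≤ 1) :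
    ∃ w : ℂ, g τ z = exp w ∧ ‖w‖ ≤ 2 / 3 * ‖τ‖ * ‖z‖ ^ 3 := by
  rcases eq_or_ne τ 0 with rfl | hτ
  · exact ⟨0, by simp [g], by simp⟩
  refine ⟨_, g_eq_exp hτ z, ?_⟩
  have hn : ‖2 * I * τ * z‖ = 2 * (‖τ‖ * ‖z‖) := by simp; ring
  have h1 := norm_log_one_add_sub_le (ζ := 2 * I * τ * z) (by rw [hn]; linarith)
  have hτ' : 0 < ‖τ‖ := norm_pos_iff.2 hτ
  rw [norm_mul]
  have h2 : ‖-(I / (8 * τ ^ 2))‖ = 1 / (8 * ‖τ‖ ^ 2) := by simp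
  rw [h2]
  calc 1 / (8 * ‖τ‖ ^ 2) * ‖log (1 + 2 * I * τ * z) - 2 * I * τ * z + (2 * I * τ * z) ^ 2 / 2‖
      ≤ 1 / (8 * ‖τ‖ ^ 2) * ((2 * (‖τ‖ * ‖z‖)) ^ 3 * (2 / 3)) := by
        rw [hn] at h1; gcongr
    _ = 2 / 3 * ‖τ‖ * ‖z‖ ^ 3 := by field_simp; norm_num

theorem norm_g_le {τ z : ℂ} (h : 4 * ‖τ‖ * (‖z‖ + 1) ≤ 1) :
    ‖g τ z‖ ≤ Real.exp (‖z‖ ^ 2 / 6) := by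
  have h0 : 4 * (‖τ‖ * ‖z‖) ≤ 1 := by nlinarith [norm_nonneg τ]
  obtain ⟨w, hw, hw'⟩ := exists_g_eq_exp h0
  rw [hw]
  refine (norm_exp_le_exp_norm w).trans (Real.exp_le_exp.2 (hw'.trans ?_))
  nlinarith [sq_nonneg ‖z‖]

/-- The singularity of `g` at `τ = 0` is removable because the exponent is `O(τ)`. -/
theorem differentiableOn_g (z : ℂ) :
    DifferentiableOn ℂ (fun τ => g τ z) (Metric.ball 0 (1 / (2 * (‖z‖ + 1)))) := by
  have hz : 0 < ‖z‖ + 1 := by positivity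
  have hs : Metric.ball (0 : ℂ) (1 / (2 * (‖z‖ + 1))) ∈ nhds (0 : ℂ) :=
    Metric.ball_mem_nhds _ (by positivity)
  rw [← differentiableOn_compl_singleton_and_continuousAt_iff hs]
  constructor
  · intro τ hτ
    have hτ0 : τ ≠ 0 := hτ.2
    have hb : ‖τ‖ < 1 / (2 * (‖z‖ + 1)) := by simpa using hτ.1
    rw [lt_div_iff₀ (by positivity)] at hb
    have hsl : 1 + 2 * I * τ * z ∈ slitPlane := by
      apply mem_slitPlane_of_norm_lt_one
      have : ‖2 * I * τ * z‖ = 2 * ‖τ‖ * ‖z‖ := by simp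
      rw [this]; nlinarith [norm_nonneg τ]
    have hd : DifferentiableAt ℂ (fun τ : ℂ => exp (-(I / (8 * τ ^ 2)) * log (1 + 2 * I * τ * z)
        - z / (4 * τ) + I * z ^ 2 / 4)) τ := by
      have h1 : DifferentiableAt ℂ (fun τ : ℂ => log (1 + 2 * I * τ * z)) τ :=
        DifferentiableAt.clog (by fun_prop) hsl
      have h2 : DifferentiableAt ℂ (fun τ : ℂ => I / (8 * τ ^ 2)) τ :=
        DifferentiableAt.fun_div (by fun_prop) (by fun_prop) (by simpa using hτ0)
      have h3 : DifferentiableAt ℂ (fun τ : ℂ => z / (4 * τ)) τ :=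
        DifferentiableAt.fun_div (by fun_prop) (by fun_prop) (by simpa using hτ0)
      fun_prop
    refine (hd.congr_of_eventuallyEq ?_).differentiableWithinAt
    filter_upwards [isOpen_ne.mem_nhds hτ0] with t ht
    rw [g, if_neg ht]
  · have h0 : g 0 z = 1 := by simp [g]
    rw [ContinuousAt, h0, tendsto_iff_norm_sub_tendsto_zero]
    have hlim : Filter.Tendsto (fun τ : ℂ => 2 * (2 / 3 * ‖τ‖ * ‖z‖ ^ 3)) (nhds 0) (nhds 0) := by
      have : Continuous (fun τ : ℂ => 2 * (2 / 3 * ‖τ‖ * ‖z‖ ^ 3)) := by fun_prop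
      simpa using this.tendsto 0
    have hlim1 : ∀ᶠ τ : ℂ in nhds 0, 2 / 3 * ‖τ‖ * ‖z‖ ^ 3 < 1 := by
      have : Continuous (fun τ : ℂ => 2 / 3 * ‖τ‖ * ‖z‖ ^ 3) := by fun_prop
      exact (this.tendsto 0).eventually_lt_const (by simp)
    have hlim2 : ∀ᶠ τ : ℂ in nhds 0, 4 * (‖τ‖ * ‖z‖) < 1 := by
      have : Continuous (fun τ : ℂ => 4 * (‖τ‖ * ‖z‖)) := by fun_prop
      exact (this.tendsto 0).eventually_lt_const (by simp)
    refine squeeze_zero' (Filter.Eventually.of_forall fun _ => norm_nonneg _) ?_ hlim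
    filter_upwards [hlim1, hlim2] with τ h1 h2
    obtain ⟨w, hw, hw'⟩ := exists_g_eq_exp h2.le
    rw [hw]
    exact (norm_exp_sub_one_le (hw'.trans h1.le)).trans (by linarith)

/-- Cauchy's estimate on the circle of radius `1 / (4 (|z| + 1))`. -/
theorem norm_P_le (k : ℕ) (z : ℂ) :
    ‖P k z‖ ≤ Real.exp (‖z‖ ^ 2 / 6) * (4 * (‖z‖ + 1)) ^ k := by
  have hz : 0 < ‖z‖ + 1 := by positivity
  have hR : 0 < 1 / (4 * (‖z‖ + 1)) := by positivity
  have hd : DiffContOnCl ℂ (fun τ => g τ z) (Metric.ball 0 (1 / (4 * (‖z‖ + 1)))) := by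
    apply DifferentiableOn.diffContOnCl_ball (U := Metric.ball 0 (1 / (2 * (‖z‖ + 1))))
      (differentiableOn_g z)
    apply Metric.closedBall_subset_ball
    apply one_div_lt_one_div_of_lt <;> linarith
  have h1 := norm_iteratedDeriv_le_of_forall_mem_sphere_norm_le k hR hd
    (C := Real.exp (‖z‖ ^ 2 / 6)) (fun τ hτ => norm_g_le (by
      have : ‖τ‖ = 1 / (4 * (‖z‖ + 1)) := by simpa using hτ
      rw [this]; apply le_of_eq; field_simp))
  have hk : (0 : ℝ) < k.factorial := by exact_mod_cast k.factorial_pos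
  rw [P, norm_div, norm_natCast, div_le_iff₀ hk]
  refine h1.trans (le_of_eq ?_)
  rw [one_div, inv_pow, div_inv_eq_mul]; ring

theorem hasSum_P {τ z : ℂ} (h : 4 * ‖τ‖ * (‖z‖ + 1) ≤ 1 / 2) :
    HasSum (fun k => P k z * τ ^ k) (g τ z) := by
  have hz : 0 < ‖z‖ + 1 := by positivity
  have := hasSum_taylorSeries_on_ball (differentiableOn_g z) (z := τ) (by
    rw [mem_ball_zero_iff, lt_div_iff₀ (by positivity)]; linarith)
  have e : (fun k => P k z * τ ^ k) =
      fun k : ℕ => ((k.factorial : ℂ))⁻¹ • (τ - 0) ^ k • iteratedDeriv k (fun τ => g τ z) 0 := by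
    funext k
    simp only [P, smul_eq_mul, sub_zero]
    ring
  rwa [e]

/-- The Taylor remainder on the disc with half the radius of Cauchy's estimate. -/
theorem norm_g_sub_sum_le {τ z : ℂ} (n : ℕ) (h : 4 * ‖τ‖ * (‖z‖ + 1) ≤ 1 / 2) :
    ‖g τ z - ∑ k ∈ Finset.range n, P k z * τ ^ k‖ ≤
      2 * Real.exp (‖z‖ ^ 2 / 6) * (4 * ‖τ‖ * (‖z‖ + 1)) ^ n := by
  set ρ := 4 * ‖τ‖ * (‖z‖ + 1) with hρ
  have hρ0 : 0 ≤ ρ := by positivity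
  have h1 := (hasSum_nat_add_iff' n).2 (hasSum_P h)
  have h2 : HasSum (fun k : ℕ => Real.exp (‖z‖ ^ 2 / 6) * ρ ^ n * ρ ^ k)
      (Real.exp (‖z‖ ^ 2 / 6) * ρ ^ n * (1 - ρ)⁻¹) :=
    (hasSum_geometric_of_lt_one hρ0 (by linarith)).mul_left _
  have h3 := h1.norm_le_of_bounded h2 (fun k => by
    rw [norm_mul, norm_pow]
    calc ‖P (k + n) z‖ * ‖τ‖ ^ (k + n)
        ≤ Real.exp (‖z‖ ^ 2 / 6) * (4 * (‖z‖ + 1)) ^ (k + n) * ‖τ‖ ^ (k + n) := by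
          gcongr; exact norm_P_le _ _
      _ = Real.exp (‖z‖ ^ 2 / 6) * ρ ^ n * ρ ^ k := by
          have e : 4 * (‖z‖ + 1) * ‖τ‖ = ρ := by rw [hρ]; ring
          rw [mul_assoc, ← mul_pow, e]; ring)
  refine h3.trans ?_
  have h4 : (1 - ρ)⁻¹ ≤ 2 := by
    rw [inv_le_comm₀ (by linarith) (by norm_num)]; linarith
  calc _ ≤ Real.exp (‖z‖ ^ 2 / 6) * ρ ^ n * 2 := by gcongr
    _ = _ := by ring

theorem measurable_g (τ : ℂ) : Measurable (g τ) := by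
  unfold g
  split_ifs
  · fun_prop
  · fun_prop

/-- Measurability in `z` is inherited from `g`: the coefficient is the limit, as `τ` tends to `0`, of
the difference between `g` and the preceding terms, divided by `τ ^ k`. -/
theorem measurable_P (k : ℕ) : Measurable (P k) := by
  induction k using Nat.strong_induction_on with
  | _ k ih =>
    have hlim : Filter.Tendsto (fun (n : ℕ) (z : ℂ) =>
        (g (1 / ((n : ℂ) + 1)) z - ∑ j ∈ Finset.range k, P j z * (1 / ((n : ℂ) + 1)) ^ j) /
          (1 / ((n : ℂ) + 1)) ^ k) Filter.atTop (nhds (P k)) := by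
      rw [tendsto_pi_nhds]
      intro z
      have ht : Filter.Tendsto (fun n : ℕ => 1 / ((n : ℝ) + 1)) Filter.atTop (nhds 0) :=
        tendsto_one_div_add_atTop_nhds_zero_nat
      rw [tendsto_iff_norm_sub_tendsto_zero]
      have hz : 0 < ‖z‖ + 1 := by positivity
      have hev : ∀ᶠ n : ℕ in Filter.atTop, 1 / ((n : ℝ) + 1) < 1 / (8 * (‖z‖ + 1)) :=
        ht.eventually_lt_const (by positivity)
      have hb : Filter.Tendsto (fun n : ℕ => 2 * Real.exp (‖z‖ ^ 2 / 6) * (4 * (‖z‖ + 1)) ^ (k + 1)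
          * (1 / ((n : ℝ) + 1))) Filter.atTop (nhds 0) := by
        simpa using ht.const_mul (2 * Real.exp (‖z‖ ^ 2 / 6) * (4 * (‖z‖ + 1)) ^ (k + 1))
      refine squeeze_zero' (Filter.Eventually.of_forall fun _ => norm_nonneg _) ?_ hb
      filter_upwards [hev] with n hn
      set t : ℝ := 1 / ((n : ℝ) + 1) with ht'
      have ht0 : 0 < t := by positivity
      have hT : (1 / ((n : ℂ) + 1)) = (t : ℂ) := by rw [ht']; push_cast; rfl
      have hTn : ‖(t : ℂ)‖ = t := by rw [norm_real, Real.norm_of_nonneg ht0.le]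
      rw [hT]
      have hT0 : (t : ℂ) ≠ 0 := by exact_mod_cast ht0.ne'
      rw [lt_div_iff₀ (by positivity)] at hn
      have h1 := norm_g_sub_sum_le (τ := t) (z := z) (k + 1) (by rw [hTn]; linarith)
      rw [Finset.sum_range_succ, hTn] at h1
      have e : (g t z - ∑ j ∈ Finset.range k, P j z * (t : ℂ) ^ j) / (t : ℂ) ^ k - P k z =
          (g t z - (∑ j ∈ Finset.range k, P j z * (t : ℂ) ^ j + P k z * (t : ℂ) ^ k)) /
            (t : ℂ) ^ k := by
        field_simp
        ring
      rw [e, norm_div, norm_pow, hTn, div_le_iff₀ (by positivity)]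
      refine h1.trans (le_of_eq ?_)
      rw [show 4 * t * (‖z‖ + 1) = 4 * (‖z‖ + 1) * t by ring, mul_pow]
      ring
    refine measurable_of_tendsto_metrizable (fun n => ?_) hlim
    refine ((measurable_g _).sub (Finset.measurable_fun_sum _ fun j hj => ?_)).div_const _
    exact (ih j (Finset.mem_range.1 hj)).mul_const _

/-! ### A residue formula for a strip -/

theorem integral_poisson {σ : ℝ} (hσ : 0 < σ) :
    MeasureTheory.Integrable (fun t : ℝ => σ / (t ^ 2 + σ ^ 2)) ∧
      ∫ t : ℝ, σ / (t ^ 2 + σ ^ 2) = Real.pi := by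
  have e : (fun t : ℝ => σ / (t ^ 2 + σ ^ 2)) = fun t => σ⁻¹ * (1 + (t / σ) ^ 2)⁻¹ := by
    funext t
    have : 0 < t ^ 2 + σ ^ 2 := by positivity
    have h2 : 0 < 1 + (t / σ) ^ 2 := by positivity
    field_simp
    ring
  rw [e]
  constructor
  · exact (integrable_inv_one_add_sq.comp_div hσ.ne').const_mul _
  · rw [MeasureTheory.integral_const_mul,
      MeasureTheory.Measure.integral_comp_div (fun t : ℝ => (1 + t ^ 2)⁻¹) σ,
      integral_univ_inv_one_add_sq, abs_of_pos hσ, smul_eq_mul, ← mul_assoc,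
      inv_mul_cancel₀ hσ.ne', one_mul]

/-- The residue theorem for a strip, for a function `B v / v` with `B` holomorphic and rapidly
decreasing on the closed strip. After subtraction of `B 0 / v` the function is holomorphic, so the
integrals over the two edges differ by `B 0` times the mass of the Poisson kernel. -/
theorem strip_residue {B : ℂ → ℂ} {σ M : ℝ} (hσ : 0 < σ)
    (hB : ∀ v : ℂ, |v.im| ≤ σ → DifferentiableAt ℂ B v)
    (hM : ∀ v : ℂ, |v.im| ≤ σ → ‖B v‖ ≤ M * Real.exp (-v.re ^ 2)) :
    (∫ t : ℝ, B (t + (-σ : ℝ) * I) / (t + (-σ : ℝ) * I)) -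
      ∫ t : ℝ, B (t + σ * I) / (t + σ * I) = 2 * Real.pi * I * B 0 := by
  have hM0 : 0 ≤ M := by
    have := (norm_nonneg _).trans (hM 0 (by simpa using hσ.le))
    simpa using this
  have hM' : ∀ v : ℂ, |v.im| ≤ σ → ‖B v‖ ≤ M := fun v hv =>
    (hM v hv).trans (mul_le_of_le_one_right hM0 (Real.exp_le_one_iff.2 (by nlinarith [sq_nonneg v.re])))
  have hint : ∀ s : ℝ, |s| = σ → MeasureTheory.Integrable
      (fun t : ℝ => B (t + s * I) / (t + s * I)) := by
    intro s hs
    have hne : ∀ t : ℝ, (t : ℂ) + s * I ≠ 0 := fun t h0 => by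
      have := congrArg im h0
      simp at this
      rw [this] at hs; simp at hs; linarith
    have hc : Continuous (fun t : ℝ => B (t + s * I) / (t + s * I)) := by
      apply Continuous.div _ (by fun_prop) hne
      rw [continuous_iff_continuousAt]
      intro t
      have h1 : ContinuousAt B (t + s * I) := (hB _ (by simp [hs])).continuousAt
      exact ContinuousAt.comp (f := fun t : ℝ => (t : ℂ) + s * I) h1 (by fun_prop)
    have hg : MeasureTheory.Integrable (fun t : ℝ => M / σ * Real.exp (-1 * t ^ 2)) :=
      (integrable_exp_neg_mul_sq one_pos).const_mul _
    refine hg.mono' hc.aestronglyMeasurable (Filter.Eventually.of_forall fun t => ?_)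
    have h1 := hM (t + s * I) (by simp [hs])
    have h2 : σ ≤ ‖(t : ℂ) + s * I‖ := by
      have := abs_im_le_norm ((t : ℂ) + s * I)
      simpa [hs] using this
    rw [norm_div]
    have h3 : ((t : ℂ) + s * I).re = t := by simp
    rw [h3] at h1
    calc _ ≤ M * Real.exp (-t ^ 2) / σ := by gcongr
      _ = _ := by rw [neg_one_mul]; ring
  have hHd : ∀ v : ℂ, |v.im| ≤ σ → DifferentiableAt ℂ (dslope B 0) v := by
    intro v hv
    rcases eq_or_ne v 0 with rfl | hv0
    · have ho : IsOpen {v : ℂ | |v.im| < σ} := isOpen_lt continuous_im.abs continuous_const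
      have hn : {v : ℂ | |v.im| < σ} ∈ nhds (0 : ℂ) := ho.mem_nhds (by simpa using hσ)
      refine DifferentiableOn.differentiableAt ?_ hn
      rw [differentiableOn_dslope hn]
      exact fun v hv => (hB v (le_of_lt hv)).differentiableWithinAt
    · exact (differentiableAt_dslope_of_ne hv0).2 (hB v hv)
  have hHv : ∀ v : ℂ, v ≠ 0 → dslope B 0 v = B v / v - B 0 / v := by
    intro v hv
    rw [dslope_of_ne _ hv, slope_def_field, sub_zero, sub_div]
  set φ : ℝ → ℂ := fun t => B (t + (-σ : ℝ) * I) / (t + (-σ : ℝ) * I) -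
    B (t + σ * I) / (t + σ * I) - 2 * I * B 0 * ((σ / (t ^ 2 + σ ^ 2) : ℝ) : ℂ) with hφ
  have hφi : MeasureTheory.Integrable φ :=
    ((hint _ (by rw [abs_neg, abs_of_pos hσ])).sub (hint _ (abs_of_pos hσ))).sub
      ((integral_poisson hσ).1.ofReal.const_mul _)
  have hφH : ∀ t : ℝ, φ t = dslope B 0 (t + (-σ : ℝ) * I) - dslope B 0 (t + σ * I) := by
    intro t
    have h1 : (t : ℂ) + (-σ : ℝ) * I ≠ 0 := fun h0 => by
      have := congrArg im h0
      simp at this; linarith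
    have h2 : (t : ℂ) + σ * I ≠ 0 := fun h0 => by
      have := congrArg im h0
      simp at this; linarith
    rw [hHv _ h1, hHv _ h2, hφ]
    have h3 : ((σ / (t ^ 2 + σ ^ 2) : ℝ) : ℂ) =
        σ / (((t : ℂ) + (-σ : ℝ) * I) * ((t : ℂ) + σ * I)) := by
      push_cast
      congr 1
      linear_combination (σ : ℂ) ^ 2 * I_sq
    have h4 : 2 * I * B 0 * ((σ / (t ^ 2 + σ ^ 2) : ℝ) : ℂ) =
        B 0 / ((t : ℂ) + (-σ : ℝ) * I) - B 0 / ((t : ℂ) + σ * I) := by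
      rw [h3, div_sub_div _ _ h1 h2, mul_div_assoc']
      congr 1
      push_cast
      ring
    simp only [h4]
    ring
  have hlim1 : Filter.Tendsto (fun T : ℝ => ∫ t in (-T)..T, φ t) Filter.atTop
      (nhds (∫ t, φ t)) :=
    MeasureTheory.intervalIntegral_tendsto_integral hφi Filter.tendsto_neg_atTop_atBot
      Filter.tendsto_id
  have hlim0 : Filter.Tendsto (fun T : ℝ => ∫ t in (-T)..T, φ t) Filter.atTop (nhds 0) := by
    have hz : Filter.Tendsto (fun T : ℝ => 8 * σ * M / T) Filter.atTop (nhds 0) :=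
      Filter.Tendsto.const_div_atTop Filter.tendsto_id _
    refine squeeze_zero_norm' ?_ hz
    filter_upwards [Filter.eventually_gt_atTop 0] with T hT
    have hrect := integral_boundary_rect_eq_zero_of_differentiableOn (dslope B 0)
      (-(T : ℂ) + (-σ : ℝ) * I) (T + σ * I) (by
        intro v hv
        have h2 := hv.2
        simp only [Set.mem_preimage] at h2
        have e1 : (-(T : ℂ) + (-σ : ℝ) * I).im = -σ := by simp
        have e2 : ((T : ℂ) + σ * I).im = σ := by simp
        rw [e1, e2, Set.uIcc_of_le (by linarith)] at h2
        exact (hHd v (abs_le.2 h2)).differentiableWithinAt)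
    have r1 : (-(T : ℂ) + (-σ : ℝ) * I).re = -T := by simp
    have r2 : ((T : ℂ) + σ * I).re = T := by simp
    have e1 : (-(T : ℂ) + (-σ : ℝ) * I).im = -σ := by simp
    have e2 : ((T : ℂ) + σ * I).im = σ := by simp
    rw [r1, r2, e1, e2] at hrect
    have hcont : ∀ s : ℝ, |s| ≤ σ → Continuous fun t : ℝ => dslope B 0 (t + s * I) := by
      intro s hs
      rw [continuous_iff_continuousAt]
      intro t
      exact ContinuousAt.comp (f := fun t : ℝ => (t : ℂ) + s * I)
        (hHd _ (by simpa using hs)).continuousAt (by fun_prop)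
    have hsplit : ∫ t in (-T)..T, φ t = (∫ t in (-T)..T, dslope B 0 (t + (-σ : ℝ) * I)) -
        ∫ t in (-T)..T, dslope B 0 (t + σ * I) := by
      rw [← intervalIntegral.integral_sub]
      · exact intervalIntegral.integral_congr fun t _ => hφH t
      · exact (hcont _ (by rw [abs_neg, abs_of_pos hσ])).intervalIntegrable _ _
      · exact (hcont _ (by rw [abs_of_pos hσ])).intervalIntegrable _ _
    -- On the vertical sides `(B v - B 0) / v` is at most `2 M / T`, and their length is `2 σ`.
    have hside : ∀ s : ℝ, |s| = T → ‖∫ y : ℝ in (-σ)..σ, dslope B 0 (s + y * I)‖ ≤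
        4 * σ * M / T := by
      intro s hs
      have := intervalIntegral.norm_integral_le_of_norm_le_const (a := -σ) (b := σ)
        (f := fun y : ℝ => dslope B 0 (s + y * I)) (C := 2 * M / T) (by
          intro y hy
          rw [Set.uIoc_of_le (by linarith)] at hy
          have hy' : |y| ≤ σ := abs_le.2 ⟨hy.1.le, hy.2⟩
          have hne : (s : ℂ) + y * I ≠ 0 := fun h0 => by
            have := congrArg re h0
            simp at this
            rw [this] at hs; simp at hs; linarith
          have hn : T ≤ ‖(s : ℂ) + y * I‖ := by
            have := abs_re_le_norm ((s : ℂ) + y * I)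
            simpa [hs] using this
          rw [hHv _ hne, ← sub_div, norm_div]
          have h1 := hM' ((s : ℂ) + y * I) (by simpa using hy')
          have h2 := hM' 0 (by simpa using hσ.le)
          have h3 := norm_sub_le (B ((s : ℂ) + y * I)) (B 0)
          gcongr
          linarith)
      refine this.trans (le_of_eq ?_)
      rw [sub_neg_eq_add, abs_of_pos (by linarith)]
      ring
    have e : ∫ t in (-T)..T, φ t = I * (∫ y : ℝ in (-σ)..σ, dslope B 0 ((-T : ℝ) + y * I)) -
        I * (∫ y : ℝ in (-σ)..σ, dslope B 0 ((T : ℝ) + y * I)) := by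
      rw [hsplit]
      simp only [smul_eq_mul] at hrect
      linear_combination hrect
    rw [e]
    refine (norm_sub_le _ _).trans ?_
    rw [norm_mul, norm_mul, norm_I, one_mul, one_mul]
    have h1 := hside (-T) (by rw [abs_neg, abs_of_pos hT])
    have h2 := hside T (abs_of_pos hT)
    calc _ ≤ 4 * σ * M / T + 4 * σ * M / T := add_le_add h1 h2
      _ = _ := by ring
  have h0 := tendsto_nhds_unique hlim1 hlim0
  rw [hφ, MeasureTheory.integral_sub, MeasureTheory.integral_sub,
    MeasureTheory.integral_const_mul, integral_complex_ofReal, (integral_poisson hσ).2] at h0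
  · linear_combination h0
  · exact hint _ (by rw [abs_neg, abs_of_pos hσ])
  · exact hint _ (abs_of_pos hσ)
  · exact (hint _ (by rw [abs_neg, abs_of_pos hσ])).sub (hint _ (abs_of_pos hσ))
  · exact (integral_poisson hσ).1.ofReal.const_mul _

/-! ### Moving the line of integration across the integers -/

/-- The direction `e^{-3πi/4}` of the lines of integration. -/
noncomputable def dir : ℂ := exp (-(3 * (Real.pi : ℂ) / 4) * I)

theorem lineIntegral_eq (c : ℂ) (f : ℂ → ℂ) :
    lineIntegral c f = ∫ u : ℝ, f (c + u * dir) * dir := rfl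

theorem norm_dir : ‖dir‖ = 1 := by
  have : dir = exp ((-(3 * Real.pi / 4) : ℝ) * I) := by rw [dir]; push_cast; rfl
  rw [this, norm_exp_ofReal_mul_I]

theorem dir_ne_zero : dir ≠ 0 := exp_ne_zero _

theorem dir_sq : dir ^ 2 = I := by
  rw [dir, ← exp_nat_mul]
  have : ((2 : ℕ) : ℂ) * (-(3 * (Real.pi : ℂ) / 4) * I) =
      (Real.pi : ℂ) / 2 * I - 2 * Real.pi * I := by push_cast; ring
  rw [this, exp_sub, exp_pi_div_two_mul_I, exp_two_pi_mul_I, div_one]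

theorem dir_eq : dir = (-(Real.sqrt 2 / 2) : ℝ) + (-(Real.sqrt 2 / 2) : ℝ) * I := by
  have h : dir = exp ((Real.pi / 4 : ℝ) * I) * exp (-(Real.pi * I)) := by
    rw [dir, ← exp_add]; congr 1; push_cast; ring
  rw [h, exp_neg, exp_pi_mul_I, exp_mul_I, ← ofReal_cos, ← ofReal_sin, Real.cos_pi_div_four,
    Real.sin_pi_div_four, show ((-1 : ℂ))⁻¹ = -1 by norm_num]
  push_cast
  ring

theorem dir_re : dir.re = -(Real.sqrt 2 / 2) := by rw [dir_eq]; simp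
theorem dir_im : dir.im = -(Real.sqrt 2 / 2) := by rw [dir_eq]; simp

theorem dir_mul_re (v : ℂ) : (dir * v).re = -(Real.sqrt 2 / 2) * (v.re - v.im) := by
  rw [mul_re, dir_re, dir_im]; ring

theorem dir_mul_im (v : ℂ) : (dir * v).im = -(Real.sqrt 2 / 2) * (v.re + v.im) := by
  rw [mul_im, dir_re, dir_im]; ring

theorem abs_im_le_norm_sin (z : ℂ) : |z.im| ≤ ‖sin z‖ := by
  have h : ‖sin z‖ ^ 2 = Real.sin z.re ^ 2 + Real.sinh z.im ^ 2 := by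
    have e : sin z = ((Real.sin z.re * Real.cosh z.im : ℝ) : ℂ) +
        ((Real.cos z.re * Real.sinh z.im : ℝ) : ℂ) * I := by
      conv_lhs => rw [← re_add_im z]
      rw [sin_add, cos_mul_I, sin_mul_I]
      push_cast
      ring
    rw [← normSq_eq_norm_sq, e, normSq_add_mul_I, mul_pow, Real.cosh_sq]
    linear_combination Real.sinh z.im ^ 2 * Real.sin_sq_add_cos_sq z.re
  have h1 : |z.im| ≤ |Real.sinh z.im| := by
    rw [Real.abs_sinh]
    exact Real.self_le_sinh_iff.2 (abs_nonneg _)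
  have h2 : |z.im| ^ 2 ≤ ‖sin z‖ ^ 2 := by
    rw [h]
    have := sq_abs (Real.sinh z.im)
    nlinarith [abs_nonneg z.im, sq_nonneg (Real.sin z.re)]
  exact (sq_le_sq₀ (abs_nonneg _) (norm_nonneg _)).1 h2

theorem norm_cpow_le {x : ℂ} (hx : x ≠ 0) (w : ℂ) :
    ‖x ^ w‖ ≤ Real.exp (‖w‖ * (‖x‖ + ‖x‖⁻¹ + 4)) := by
  rw [cpow_def_of_ne_zero hx]
  refine (norm_exp_le_exp_norm _).trans (Real.exp_le_exp.2 ?_)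
  rw [norm_mul, mul_comm]
  exact mul_le_mul_of_nonneg_left (norm_log_le x) (norm_nonneg _)

theorem half_le_of_strip {v : ℂ} {n : ℝ} (hn : 1 ≤ n) (hv : |v.im| ≤ Real.sqrt 2 / 4) :
    1 / 2 ≤ ((n : ℂ) + dir * v).re - ((n : ℂ) + dir * v).im := by
  rw [add_re, add_im, dir_mul_re, dir_mul_im, ofReal_re, ofReal_im]
  have h2 : Real.sqrt 2 * Real.sqrt 2 = 2 := Real.mul_self_sqrt (by norm_num)
  have h3 : 0 < Real.sqrt 2 := by positivity
  have h1 := (abs_le.1 hv).1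
  nlinarith

theorem mem_slitPlane_of_half_le {x : ℂ} (h : 1 / 2 ≤ x.re - x.im) : x ∈ slitPlane := by
  rcases lt_or_ge 0 x.re with h1 | h1
  · exact Or.inl h1
  · exact Or.inr (by intro h2; linarith)

theorem norm_ge_of_half_le {x : ℂ} (h : 1 / 2 ≤ x.re - x.im) : 1 / 4 ≤ ‖x‖ := by
  have h1 := (abs_le.1 (abs_re_le_norm x)).2
  have h2 := (abs_le.1 (abs_im_le_norm x)).1
  linarith

theorem norm_le_add_of_im {v : ℂ} {σ : ℝ} (h : |v.im| ≤ σ) : ‖v‖ ≤ |v.re| + σ :=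
  (norm_le_abs_re_add_abs_im v).trans (by linarith)

theorem sqrt_two_bounds : 1.4142 < Real.sqrt 2 ∧ Real.sqrt 2 < 1.4143 := by
  constructor
  · exact Real.lt_sqrt_of_sq_lt (by norm_num)
  · rw [Real.sqrt_lt' (by norm_num)]; norm_num

/-- The Gaussian `e^{πi x²}` has modulus about `e^{-π t²}` for `x = n + dir (t + i r)`, which
dominates the power of `x`, uniformly in the strip around `n` between the two lines. -/
theorem exists_bound_numerator (w : ℂ) {n : ℝ} (hn : 1 ≤ n) :
    ∃ M : ℝ, 0 ≤ M ∧ ∀ v : ℂ, |v.im| ≤ Real.sqrt 2 / 4 →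
      ‖((n : ℂ) + dir * v) ^ (-w) * exp ((Real.pi : ℂ) * I * ((n : ℂ) + dir * v) ^ 2)‖ ≤
        M * Real.exp (-v.re ^ 2) := by
  set A := ‖w‖ * (n + 9) + Real.pi * (2 * n + 1) with hA
  have hpi := Real.pi_gt_three
  have hA0 : 0 ≤ A := by positivity
  refine ⟨Real.exp (A + A ^ 2), (Real.exp_pos _).le, fun v hv => ?_⟩
  obtain ⟨hs1, hs2⟩ := sqrt_two_bounds
  have hh := half_le_of_strip hn hv
  set x := (n : ℂ) + dir * v with hx
  have hx0 : x ≠ 0 := slitPlane_ne_zero (mem_slitPlane_of_half_le hh)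
  have hv1 : ‖v‖ ≤ |v.re| + 1 := norm_le_add_of_im (by linarith)
  have hxn : ‖x‖ ≤ n + |v.re| + 1 := by
    have h1 := norm_add_le (n : ℂ) (dir * v)
    rw [norm_mul, norm_dir, one_mul, norm_real, Real.norm_of_nonneg (by linarith)] at h1
    linarith
  have hxi : ‖x‖⁻¹ ≤ 4 := by
    rw [inv_le_comm₀ (norm_pos_iff.2 hx0) (by norm_num)]
    have := norm_ge_of_half_le hh
    norm_num at this ⊢; exact this
  have h1 : ‖x ^ (-w)‖ ≤ Real.exp (‖w‖ * (n + |v.re| + 9)) := by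
    refine (norm_cpow_le hx0 _).trans (Real.exp_le_exp.2 ?_)
    rw [norm_neg]
    exact mul_le_mul_of_nonneg_left (by linarith) (norm_nonneg _)
  have h2 : ‖exp ((Real.pi : ℂ) * I * x ^ 2)‖ ≤
      Real.exp (Real.pi * (2 * n * (|v.re| + 1)) - Real.pi * (v.re ^ 2 - 1)) := by
    rw [norm_exp]
    apply Real.exp_le_exp.2
    have e : (Real.pi : ℂ) * I * x ^ 2 = (Real.pi * (n ^ 2) : ℝ) * I +
        (Real.pi * (2 * n) : ℝ) * (I * (dir * v)) - (Real.pi : ℝ) * v ^ 2 := by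
      rw [hx]
      push_cast
      linear_combination (Real.pi : ℂ) * I * v ^ 2 * dir_sq + (Real.pi : ℂ) * v ^ 2 * I_sq
    rw [e, sub_re, add_re, re_ofReal_mul, re_ofReal_mul, re_ofReal_mul, I_re]
    have h3 : (I * (dir * v)).re ≤ |v.re| + 1 := by
      refine ((abs_le.1 (abs_re_le_norm _)).2).trans ?_
      rw [norm_mul, norm_mul, norm_I, norm_dir, one_mul, one_mul]; exact hv1
    have h4 : v.re ^ 2 - 1 ≤ (v ^ 2).re := by
      rw [sq v, mul_re]
      have := abs_le.1 hv
      nlinarith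
    have h5 := mul_le_mul_of_nonneg_left h3 (by positivity : 0 ≤ Real.pi * (2 * n))
    have h6 := mul_le_mul_of_nonneg_left h4 Real.pi_pos.le
    linarith
  rw [norm_mul, ← Real.exp_add]
  refine (mul_le_mul h1 h2 (norm_nonneg _) (Real.exp_pos _).le).trans ?_
  rw [← Real.exp_add]
  apply Real.exp_le_exp.2
  have h7 : ‖w‖ * (n + |v.re| + 9) + (Real.pi * (2 * n * (|v.re| + 1)) - Real.pi * (v.re ^ 2 - 1))
      ≤ A * (1 + |v.re|) - Real.pi * |v.re| ^ 2 := by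
    rw [sq_abs, hA]
    have : 0 ≤ ‖w‖ * ((n + 8) * |v.re|) := by positivity
    have : 0 ≤ Real.pi * |v.re| := by positivity
    nlinarith
  refine h7.trans ?_
  rw [← sq_abs v.re]
  nlinarith [sq_nonneg (A - |v.re|), sq_nonneg (|v.re|), abs_nonneg v.re]

/-- The integrand of `auxR`. -/
noncomputable def kernel (w x : ℂ) : ℂ :=
  x ^ (-w) * exp ((Real.pi : ℂ) * I * x ^ 2) /
    (exp ((Real.pi : ℂ) * I * x) - exp (-((Real.pi : ℂ) * I * x)))

theorem exp_sub_exp_eq_sin (x : ℂ) :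
    exp ((Real.pi : ℂ) * I * x) - exp (-((Real.pi : ℂ) * I * x)) =
      2 * I * sin ((Real.pi : ℂ) * x) := by
  rw [sin, show -((Real.pi : ℂ) * x) * I = -((Real.pi : ℂ) * I * x) by ring,
    show (Real.pi : ℂ) * x * I = (Real.pi : ℂ) * I * x by ring]
  linear_combination (exp ((Real.pi : ℂ) * I * x) - exp (-((Real.pi : ℂ) * I * x))) * I_sq

/-- The entire function `v ↦ sin (π dir v) / v`. -/
noncomputable def sinQuot : ℂ → ℂ := dslope (fun v => sin ((Real.pi : ℂ) * (dir * v))) 0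

theorem differentiable_sinQuot : Differentiable ℂ sinQuot := by
  have h : DifferentiableOn ℂ sinQuot Set.univ := by
    rw [sinQuot, differentiableOn_dslope Filter.univ_mem]
    fun_prop
  exact differentiableOn_univ.1 h

theorem sinQuot_zero : sinQuot 0 = (Real.pi : ℂ) * dir := by
  rw [sinQuot, dslope_same]
  have h : HasDerivAt (fun v : ℂ => (Real.pi : ℂ) * (dir * v)) ((Real.pi : ℂ) * (dir * 1)) 0 :=
    ((hasDerivAt_id _).const_mul _).const_mul _
  rw [h.csin.deriv]
  simp

theorem sinQuot_of_ne {v : ℂ} (hv : v ≠ 0) :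
    sinQuot v = sin ((Real.pi : ℂ) * (dir * v)) / v := by
  rw [sinQuot, dslope_of_ne _ hv, slope_def_field]; simp

/-- The zero of `sin (π x)` at `n` is the only one between the lines through `n - 1/2` and
`n + 1/2`. -/
theorem sinQuot_ne_zero {v : ℂ} (hv : |v.im| ≤ Real.sqrt 2 / 4) : sinQuot v ≠ 0 := by
  have hpi : (Real.pi : ℂ) ≠ 0 := by exact_mod_cast Real.pi_ne_zero
  rcases eq_or_ne v 0 with rfl | h0
  · rw [sinQuot_zero]; exact mul_ne_zero hpi dir_ne_zero
  rw [sinQuot_of_ne h0]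
  refine div_ne_zero (fun hs => ?_) h0
  rw [sin_eq_zero_iff] at hs
  obtain ⟨k, hk⟩ := hs
  have h1 : dir * v = ((k : ℝ) : ℂ) := by
    have : (Real.pi : ℂ) * (dir * v) = Real.pi * ((k : ℝ) : ℂ) := by rw [hk]; push_cast; ring
    exact mul_left_cancel₀ hpi this
  have h2 := congrArg im h1
  have h3 := congrArg re h1
  rw [dir_mul_im, ofReal_im] at h2
  rw [dir_mul_re, ofReal_re] at h3
  have hs := Real.mul_self_sqrt (show (0 : ℝ) ≤ 2 by norm_num)
  have hs0 : 0 < Real.sqrt 2 := by positivity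
  have h4 : v.re + v.im = 0 := by
    rcases mul_eq_zero.1 h2 with h | h
    · linarith
    · exact h
  have h5 : (k : ℝ) = Real.sqrt 2 * v.im := by
    rw [← h3, show v.re = -v.im by linarith]; ring
  have h6 : |(k : ℝ)| < 1 := by
    rw [h5, abs_mul, abs_of_pos hs0]
    nlinarith
  have h7 : k = 0 := by
    have : |k| < 1 := by exact_mod_cast h6
    exact Int.abs_lt_one_iff.1 this
  rw [h7] at h1
  simp at h1
  exact h1.elim dir_ne_zero h0

theorem one_le_norm_sinQuot {v : ℂ} (hv : |v.im| ≤ Real.sqrt 2 / 4) (hr : 1 ≤ |v.re|) :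
    1 ≤ ‖sinQuot v‖ := by
  have h0 : v ≠ 0 := fun h => by rw [h] at hr; simp at hr; linarith
  obtain ⟨hs1, hs2⟩ := sqrt_two_bounds
  have hpi := Real.pi_gt_d2
  rw [sinQuot_of_ne h0, norm_div, le_div_iff₀ (norm_pos_iff.2 h0), one_mul]
  refine (norm_le_add_of_im hv).trans (le_trans ?_ (abs_im_le_norm_sin _))
  rw [im_ofReal_mul, dir_mul_im, abs_mul, abs_mul, abs_neg, abs_of_pos Real.pi_pos,
    abs_of_pos (by linarith : 0 < Real.sqrt 2 / 2)]
  have h1 : |v.re| - Real.sqrt 2 / 4 ≤ |v.re + v.im| := by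
    have := abs_sub_abs_le_abs_sub v.re (-v.im)
    rw [abs_neg, sub_neg_eq_add] at this
    linarith
  have h2 : 2.2 ≤ Real.pi * (Real.sqrt 2 / 2) := by nlinarith
  rw [← mul_assoc]
  nlinarith [abs_nonneg (v.re + v.im)]

/-- Moving the line of integration from `n - 1/2` to `n + 1/2` collects the residue at `n`. -/
theorem lineIntegral_kernel_step (w : ℂ) {n : ℕ} (hn : 1 ≤ n) :
    lineIntegral ((n : ℂ) - 1 / 2) (kernel w) =
      (n : ℂ) ^ (-w) + lineIntegral ((n : ℂ) + 1 / 2) (kernel w) := by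
  have hpi : (Real.pi : ℂ) ≠ 0 := by exact_mod_cast Real.pi_ne_zero
  have hn' : (1 : ℝ) ≤ (n : ℝ) := by exact_mod_cast hn
  have hs := Real.mul_self_sqrt (show (0 : ℝ) ≤ 2 by norm_num)
  set σ := Real.sqrt 2 / 4 with hσ
  have hσ0 : 0 < σ := by rw [hσ]; positivity
  set N : ℂ → ℂ := fun v => ((n : ℂ) + dir * v) ^ (-w) *
    exp ((Real.pi : ℂ) * I * ((n : ℂ) + dir * v) ^ 2) with hN
  set B : ℂ → ℂ := fun v => dir * N v / (2 * I * (-1) ^ n * sinQuot v) with hBdef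
  have hunit : ‖(2 * I * (-1) ^ n : ℂ)‖ = 2 := by simp
  have hunit0 : (2 * I * (-1) ^ n : ℂ) ≠ 0 := norm_pos_iff.1 (by rw [hunit]; norm_num)
  have hBd : ∀ v : ℂ, |v.im| ≤ σ → DifferentiableAt ℂ B v := by
    intro v hv
    have h1 : (n : ℂ) + dir * v ∈ slitPlane :=
      mem_slitPlane_of_half_le (half_le_of_strip hn' hv)
    have h2 : DifferentiableAt ℂ N v := by
      refine DifferentiableAt.fun_mul (DifferentiableAt.cpow (by fun_prop) (by fun_prop) h1)
        (by fun_prop)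
    have h3 := differentiable_sinQuot v
    exact DifferentiableAt.fun_div (by fun_prop) (by fun_prop)
      (mul_ne_zero hunit0 (sinQuot_ne_zero hv))
  obtain ⟨M, hM⟩ : ∃ M : ℝ, ∀ v : ℂ, |v.im| ≤ σ → ‖B v‖ ≤ M * Real.exp (-v.re ^ 2) := by
    obtain ⟨M₁, hM₁, hb⟩ := exists_bound_numerator w hn'
    have hc : IsCompact (Set.Icc (-1 : ℝ) 1 ×ℂ Set.Icc (-σ) σ) := isCompact_Icc.reProdIm isCompact_Icc
    obtain ⟨M₂, hM₂⟩ := hc.exists_bound_of_continuousOn (f := B)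
      (fun v hv => (hBd v (abs_le.2 hv.2)).continuousAt.continuousWithinAt)
    refine ⟨max M₁ (M₂ * Real.exp 1), fun v hv => ?_⟩
    -- Far out the Gaussian decides; the rest of the strip is compact.
    rcases le_or_gt 1 |v.re| with hr | hr
    · refine le_trans ?_ (mul_le_mul_of_nonneg_right (le_max_left _ _) (Real.exp_pos _).le)
      refine le_trans ?_ (hb v hv)
      have h1 := one_le_norm_sinQuot hv hr
      rw [hBdef]
      simp only [norm_div, norm_mul dir, norm_dir, one_mul, norm_mul _ (sinQuot v), hunit]
      exact div_le_self (norm_nonneg _) (by linarith)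
    · refine le_trans ?_ (mul_le_mul_of_nonneg_right (le_max_right _ _) (Real.exp_pos _).le)
      have h1 := hM₂ v ⟨abs_le.1 hr.le, abs_le.1 hv⟩
      have h2 : (1 : ℝ) ≤ Real.exp 1 * Real.exp (-v.re ^ 2) := by
        rw [← Real.exp_add]
        apply Real.one_le_exp
        have := (sq_lt_one_iff_abs_lt_one v.re).2 hr
        linarith
      have h3 : 0 ≤ M₂ := (norm_nonneg _).trans h1
      calc ‖B v‖ ≤ M₂ * 1 := by linarith
        _ ≤ M₂ * (Real.exp 1 * Real.exp (-v.re ^ 2)) := mul_le_mul_of_nonneg_left h2 h3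
        _ = _ := by ring
  have hres := strip_residue hσ0 hBd hM
  have hB0 : 2 * Real.pi * I * B 0 = (n : ℂ) ^ (-w) := by
    have h1 : exp ((Real.pi : ℂ) * I * (n : ℂ) ^ 2) = (-1) ^ n := by
      rw [show (Real.pi : ℂ) * I * (n : ℂ) ^ 2 = ((n * n : ℕ) : ℂ) * (Real.pi * I) by
        push_cast; ring, exp_nat_mul, exp_pi_mul_I, pow_mul]
      rcases Nat.even_or_odd n with h | h
      · simp [h.neg_one_pow]
      · simp [h.neg_one_pow]
    simp only [hBdef, hN, sinQuot_zero, mul_zero, add_zero, h1]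
    have := dir_ne_zero
    have h2 : ((-1 : ℂ)) ^ n ≠ 0 := pow_ne_zero _ (by norm_num)
    field_simp
  have hker : ∀ v : ℂ, v ≠ 0 → kernel w ((n : ℂ) + dir * v) * dir = B v / v := by
    intro v hv
    have h1 : sin ((Real.pi : ℂ) * ((n : ℂ) + dir * v)) =
        (-1) ^ n * sin ((Real.pi : ℂ) * (dir * v)) := by
      rw [mul_add, add_comm, mul_comm (Real.pi : ℂ) (n : ℂ), sin_antiperiodic.add_nat_mul_eq]
    rw [kernel, exp_sub_exp_eq_sin, h1, hBdef]
    simp only [sinQuot_of_ne hv]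
    rw [← mul_assoc (2 * I : ℂ), div_div, mul_assoc _ _ v, div_mul_cancel₀ _ hv, hN]
    ring
  -- Along `dir` the lines through `n ∓ 1/2` are the edges of the strip, shifted by `±σ` in the
  -- direction of the line.
  have hdirσ : dir * ((σ : ℝ) + (-σ : ℝ) * I) = -(1 / 2) := by
    apply Complex.ext
    · rw [dir_mul_re]; simp; rw [hσ]; linarith
    · rw [dir_mul_im]; simp
  have hminus : lineIntegral ((n : ℂ) - 1 / 2) (kernel w) =
      ∫ t : ℝ, B (t + (-σ : ℝ) * I) / (t + (-σ : ℝ) * I) := by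
    rw [lineIntegral_eq,
      ← MeasureTheory.integral_add_right_eq_self
        (fun t : ℝ => B (t + (-σ : ℝ) * I) / (t + (-σ : ℝ) * I)) σ]
    congr 1
    funext u
    rw [← hker]
    · congr 2
      push_cast at hdirσ ⊢
      linear_combination -hdirσ
    · intro h0
      have := congrArg im h0
      simp at this; linarith
  have hplus : lineIntegral ((n : ℂ) + 1 / 2) (kernel w) =
      ∫ t : ℝ, B (t + σ * I) / (t + σ * I) := by
    rw [lineIntegral_eq,
      ← MeasureTheory.integral_add_right_eq_self
        (fun t : ℝ => B (t + σ * I) / (t + σ * I)) (-σ)]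
    congr 1
    funext u
    rw [← hker]
    · congr 2
      push_cast at hdirσ ⊢
      linear_combination hdirσ
    · intro h0
      have := congrArg im h0
      simp at this; linarith
  rw [hminus, hplus, ← hB0, ← hres]
  ring

theorem auxR_eq_sum_add (w : ℂ) (m : ℕ) :
    auxR w = ∑ n ∈ Finset.Icc 1 m, (n : ℂ) ^ (-w) +
      lineIntegral ((m : ℂ) + 1 / 2) (kernel w) := by
  induction m with
  | zero => simp [auxR]; rfl
  | succ m ih =>
    rw [Finset.sum_Icc_succ_top (by omega), ih, add_assoc,
      ← lineIntegral_kernel_step w (by omega)]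
    congr 2
    push_cast; ring

/-! ### Bounds for the integrand of the remainder -/

/-- The exponent obtained by factoring out the value of the integrand at the saddle point. -/
theorem exp_mul_g {a : ℂ} (ha : a ≠ 0) (y : ℂ) :
    exp ((Real.pi : ℂ) * I / 2 * y ^ 2) *
        g (-(1 / (4 * (Real.sqrt Real.pi : ℂ))) / a) (I * (Real.sqrt Real.pi : ℂ) * y) =
      exp (-(2 * Real.pi * I * a ^ 2) *
        (log (1 + y / (2 * a)) - y / (2 * a) - (y / (2 * a)) ^ 2 / 2)) := by
  have hs : (Real.sqrt Real.pi : ℂ) ^ 2 = Real.pi := by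
    rw [← ofReal_pow, Real.sq_sqrt Real.pi_pos.le]
  have hs0 : (Real.sqrt Real.pi : ℂ) ≠ 0 := by
    exact_mod_cast (Real.sqrt_pos.2 Real.pi_pos).ne'
  set r := (Real.sqrt Real.pi : ℂ) with hr
  have hτ : -(1 / (4 * r)) / a ≠ 0 :=
    div_ne_zero (neg_ne_zero.2 (div_ne_zero one_ne_zero (mul_ne_zero (by norm_num) hs0))) ha
  have hζ : 2 * I * (-(1 / (4 * r)) / a) * (I * r * y) = y / (2 * a) := by
    field_simp
    linear_combination (-4 * y : ℂ) * I_sq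
  have hc : -(I / (8 * (-(1 / (4 * r)) / a) ^ 2)) = -(2 * Real.pi * I * a ^ 2) := by
    rw [← hs]; field_simp; norm_num
  rw [g_eq_exp hτ, hζ, hc, ← exp_add]
  congr 1
  field_simp
  ring

/-- In the half-plane `Im x < Re x` the principal logarithm is the branch with imaginary part
between `-3π/4` and `π/4`. -/
theorem exists_exp_eq_of_halfPlane {x : ℂ} (hx : 0 < x.re - x.im) :
    ∃ l : ℂ, exp l = x ∧ log x = l ∧ -(3 * Real.pi / 4) < l.im ∧ l.im < Real.pi / 4 := by
  set β : ℂ := -dir with hβ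
  have hβe : β = exp ((Real.pi / 4 : ℝ) * I) := by
    have h : dir = exp ((Real.pi / 4 : ℝ) * I) * exp (-(Real.pi * I)) := by
      rw [dir, ← exp_add]; congr 1; push_cast; ring
    rw [hβ, h, exp_neg, exp_pi_mul_I]; ring
  have hre : 0 < (β * x).re := by
    rw [hβ, neg_mul, neg_re, dir_mul_re]
    have : 0 < Real.sqrt 2 := by positivity
    nlinarith
  have hβx : β * x ≠ 0 := fun h => by rw [h] at hre; simp at hre
  have harg := abs_lt.1 (abs_arg_lt_pi_div_two_iff.2 (Or.inl hre))
  have him : (log (β * x) - (Real.pi / 4 : ℝ) * I).im = arg (β * x) - Real.pi / 4 := by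
    rw [sub_im, log_im, im_ofReal_mul, I_im, mul_one]
  have hexp : exp (log (β * x) - (Real.pi / 4 : ℝ) * I) = x := by
    rw [exp_sub, exp_log hβx, ← hβe, mul_div_cancel_left₀ _ (hβe ▸ exp_ne_zero _)]
  refine ⟨_, hexp, ?_, by rw [him]; linarith, by rw [him]; linarith⟩
  have hpi := Real.pi_pos
  conv_lhs => rw [← hexp]
  exact log_exp (by rw [him]; linarith) (by rw [him]; linarith)

theorem log_div_of_halfPlane {x a : ℂ} (hx : 0 < x.re - x.im) (ha : 0 < a.re - a.im) :
    log (x / a) = log x - log a := by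
  obtain ⟨l, hl, hlx, h1, h2⟩ := exists_exp_eq_of_halfPlane hx
  obtain ⟨k, hk, hka, h3, h4⟩ := exists_exp_eq_of_halfPlane ha
  rw [hlx, hka, ← hl, ← hk, ← exp_sub]
  exact log_exp (by rw [sub_im]; linarith) (by rw [sub_im]; linarith)

/-- For `a` in a closed sector inside the half-plane and large `Re V`, the point `dir * V / (2 * a)`
stays away from the real axis, since `V` is nearly real. -/
theorem phase_sector {a V : ℂ} {δ : ℝ} (hδ : 0 < δ) (ha : 1 ≤ ‖a‖)
    (hcone : δ * ‖a‖ ≤ a.re - a.im) (hV : |V.im| ≤ 1) (hX : 4 / δ + 2 ≤ |V.re|) :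
    δ / 4 * ‖dir * V / (2 * a)‖ ≤ |(dir * V / (2 * a)).im| := by
  obtain ⟨hs1, hs2⟩ := sqrt_two_bounds
  have ha0 : a ≠ 0 := norm_pos_iff.1 (by linarith)
  set κ := dir * (starRingEnd ℂ) a with hκ
  have hκn : ‖κ‖ = ‖a‖ := by rw [hκ, norm_mul, norm_dir, one_mul, norm_conj]
  have hκi : δ / 2 * ‖a‖ ≤ |κ.im| := by
    rw [hκ, dir_mul_im, conj_re, conj_im, abs_mul, abs_neg,
      abs_of_pos (by linarith : 0 < Real.sqrt 2 / 2)]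
    have := le_abs_self (a.re + -a.im)
    have h0 : 0 ≤ δ * ‖a‖ := by positivity
    nlinarith
  have hζ : dir * V / (2 * a) = ((1 / (2 * ‖a‖ ^ 2) : ℝ) : ℂ) * (κ * V) := by
    have h1 : a * (starRingEnd ℂ) a = ((‖a‖ : ℝ) : ℂ) ^ 2 := mul_conj' a
    have h2 : (starRingEnd ℂ) a ≠ 0 := (map_ne_zero _).2 ha0
    rw [hκ]
    push_cast
    rw [← h1]
    field_simp
  have hpos : 0 < 1 / (2 * ‖a‖ ^ 2) := by positivity
  rw [hζ, norm_mul, norm_real, Real.norm_of_nonneg hpos.le, im_ofReal_mul, abs_mul,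
    abs_of_pos hpos, mul_left_comm]
  refine mul_le_mul_of_nonneg_left ?_ hpos.le
  have h1 : ‖κ * V‖ ≤ ‖a‖ * (|V.re| + 1) := by
    rw [norm_mul, hκn]
    exact mul_le_mul_of_nonneg_left (norm_le_add_of_im hV) (norm_nonneg _)
  have h2 : δ / 2 * ‖a‖ * |V.re| - ‖a‖ ≤ |(κ * V).im| := by
    rw [mul_im]
    have e1 : |κ.im * V.re| - |κ.re * V.im| ≤ |κ.re * V.im + κ.im * V.re| := by
      have := abs_sub_abs_le_abs_sub (κ.im * V.re) (-(κ.re * V.im))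
      rw [abs_neg, sub_neg_eq_add, add_comm (κ.im * V.re)] at this
      exact this
    rw [abs_mul, abs_mul] at e1
    have e2 : |κ.re| * |V.im| ≤ ‖a‖ * 1 :=
      mul_le_mul (hκn ▸ abs_re_le_norm κ) hV (abs_nonneg _) (norm_nonneg _)
    have e3 := mul_le_mul_of_nonneg_right hκi (abs_nonneg V.re)
    linarith
  have h3 : 4 + 2 * δ ≤ δ * |V.re| := by
    have := mul_le_mul_of_nonneg_left hX hδ.le
    rw [mul_add, mul_div_cancel₀ _ hδ.ne'] at this
    linarith
  have h4 : δ / 4 * (‖a‖ * (|V.re| + 1)) ≤ δ / 2 * ‖a‖ * |V.re| - ‖a‖ := by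
    have := mul_le_mul_of_nonneg_left h3 (norm_nonneg a)
    nlinarith [norm_nonneg a]
  exact (mul_le_mul_of_nonneg_left h1 (by positivity)).trans (h4.trans h2)

/-- Away from the saddle point the integrand has Gaussian decay, uniformly in a sector. The
distance of the line of integration from the origin enters only when `a` is bounded. -/
theorem exists_exp_phase_bound {δ : ℝ} (hδ : 0 < δ) :
    ∃ c > 0, ∃ C > 0, ∀ a V : ℂ, 1 ≤ ‖a‖ → δ * ‖a‖ ≤ a.re - a.im → |V.im| ≤ 1 →
      1 / 2 ≤ (a + dir * V / 2).re - (a + dir * V / 2).im → ‖a‖ ≤ 2 * |V.re| + 4 →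
      ‖exp (-(2 * Real.pi * I * a ^ 2) *
        (log (1 + dir * V / (2 * a)) - dir * V / (2 * a) - (dir * V / (2 * a)) ^ 2 / 2))‖ ≤
      Real.exp (C * (1 + |V.re|) - c * V.re ^ 2) := by
  obtain ⟨c, hc, C, hC, hQ⟩ := exists_phase_bound (δ := δ / 4) (by positivity)
  -- For `|Re V| ≥ X₀` the point `ζ` lies in a sector and satisfies `|ζ| ≥ 1 / 8`; for smaller `Re V`
  -- the last hypothesis bounds `a`.
  set X₀ := 4 / δ + 2 with hX₀
  have hX₀2 : 2 ≤ X₀ := by rw [hX₀]; have : 0 < 4 / δ := by positivity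
                           linarith
  set A := 2 * X₀ + 4 with hA
  set C₁ := 2 * Real.pi * A ^ 2 * (4 * A + 2 * X₀ + 8 + X₀ ^ 2) with hC₁
  have hpi := Real.pi_gt_three
  have hC₁0 : 0 ≤ C₁ := by positivity
  refine ⟨c, hc, Real.pi * (c + C) + C₁ + c * X₀ ^ 2, by positivity, ?_⟩
  intro a V ha hcone hV hx hreg
  have ha0 : a ≠ 0 := norm_pos_iff.1 (by linarith)
  set ζ := dir * V / (2 * a) with hζ
  have hζn : ‖ζ‖ = ‖V‖ / (2 * ‖a‖) := by
    rw [hζ, norm_div, norm_mul, norm_mul, norm_dir, one_mul]; simp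
  have hVX : |V.re| ≤ ‖V‖ := abs_re_le_norm V
  have hVX' : ‖V‖ ≤ |V.re| + 1 := norm_le_add_of_im hV
  rcases le_or_gt X₀ |V.re| with hX | hX
  · have h1 := phase_sector hδ ha hcone hV hX
    have h2 : 1 / 8 ≤ ‖ζ‖ := by
      rw [hζn, div_le_div_iff₀ (by norm_num) (by positivity)]
      linarith
    obtain ⟨h3, h4⟩ := hQ ζ h1 h2
    have hζ0 : ζ ≠ 0 := norm_pos_iff.1 (by linarith)
    have e : -(2 * Real.pi * I * a ^ 2) * (log (1 + ζ) - ζ - ζ ^ 2 / 2) =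
        (Real.pi / 2 : ℝ) * (V ^ 2 * phase ζ) := by
      have h5 : log (1 + ζ) - ζ - ζ ^ 2 / 2 = ζ ^ 2 * phase ζ := by
        rw [phase]; field_simp
      have h6 : a ^ 2 * ζ ^ 2 = I * V ^ 2 / 4 := by
        rw [hζ, ← dir_sq]; field_simp; norm_num
      rw [h5]
      push_cast
      linear_combination (-(2 * Real.pi * I * phase ζ) : ℂ) * h6
        - (Real.pi * V ^ 2 * phase ζ / 2 : ℂ) * I_sq
    rw [e, norm_exp, re_ofReal_mul, mul_re, sq V, mul_re, mul_im]
    apply Real.exp_le_exp.2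
    have h5 : |(phase ζ).im| ≤ C := (abs_im_le_norm _).trans h4
    have h6 : -((V.re * V.im + V.im * V.re) * (phase ζ).im) ≤ 2 * |V.re| * C := by
      have h7 : |V.re * V.im * (phase ζ).im| ≤ |V.re| * 1 * C := by
        rw [abs_mul, abs_mul]
        gcongr
      have := (abs_le.1 h7).1
      nlinarith
    have h8 : V.im ^ 2 ≤ 1 := (sq_le_one_iff_abs_le_one _).2 hV
    have h9 : (V.re * V.re - V.im * V.im) * (phase ζ).re ≤ -(c * V.re ^ 2) + c := by
      have : 4 ≤ V.re ^ 2 := by rw [← sq_abs]; nlinarith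
      have := mul_le_mul_of_nonneg_left h3 (by nlinarith : 0 ≤ V.re * V.re - V.im * V.im)
      nlinarith
    have h10 : 0 ≤ c * V.re ^ 2 := by positivity
    have h11 : 0 ≤ Real.pi * c * |V.re| := by positivity
    have h12 : 0 ≤ (C₁ + c * X₀ ^ 2) * (1 + |V.re|) := by positivity
    have h13 : 0 < Real.pi * c := by positivity
    have h14 : 0 < Real.pi * C := by positivity
    have h15 : (V.re * V.re - V.im * V.im) * (phase ζ).re - (V.re * V.im + V.im * V.re) *
      (phase ζ).im ≤ -(c * V.re ^ 2) + c + 2 * |V.re| * C := by linarith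
    have h16 := mul_le_mul_of_nonneg_left h15 (by positivity : 0 ≤ Real.pi / 2)
    have h17 : c * V.re ^ 2 ≤ Real.pi / 2 * (c * V.re ^ 2) :=
      le_mul_of_one_le_left h10 (by linarith)
    linarith
  · have haA : ‖a‖ ≤ A := by linarith
    have h1 : 1 + ζ = (a + dir * V / 2) / a := by rw [hζ]; field_simp
    -- The line stays away from the origin, so the logarithm is bounded.
    have h2 : 1 / (4 * A) ≤ ‖1 + ζ‖ := by
      rw [h1, norm_div, div_le_div_iff₀ (by positivity) (by positivity)]
      have := norm_ge_of_half_le hx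
      nlinarith
    have h3 : ‖1 + ζ‖⁻¹ ≤ 4 * A := by
      rw [inv_le_comm₀ (lt_of_lt_of_le (by positivity) h2) (by positivity), ← one_div]
      exact h2
    have h4 : ‖ζ‖ ≤ X₀ := by
      rw [hζn, div_le_iff₀ (by positivity)]
      nlinarith
    have h5 : ‖1 + ζ‖ ≤ 1 + X₀ := (norm_add_le _ _).trans (by simpa using h4)
    have h6 := norm_log_le (1 + ζ)
    have h7 : ‖log (1 + ζ) - ζ - ζ ^ 2 / 2‖ ≤ 4 * A + 2 * X₀ + 8 + X₀ ^ 2 := by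
      have e1 := norm_sub_le (log (1 + ζ) - ζ) (ζ ^ 2 / 2)
      have e2 := norm_sub_le (log (1 + ζ)) ζ
      have e3 : ‖ζ ^ 2 / 2‖ ≤ X₀ ^ 2 := by
        rw [norm_div, norm_pow, norm_ofNat]
        have : ‖ζ‖ ^ 2 ≤ X₀ ^ 2 := by gcongr
        have : 0 ≤ ‖ζ‖ ^ 2 := by positivity
        linarith
      linarith
    have h8 : ‖(-(2 * Real.pi * I * a ^ 2) : ℂ)‖ ≤ 2 * Real.pi * A ^ 2 := by
      rw [norm_neg, norm_mul, norm_mul, norm_mul, norm_I, norm_pow, norm_ofNat, norm_real,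
        Real.norm_of_nonneg Real.pi_pos.le, mul_one]
      gcongr
    refine (norm_exp_le_exp_norm _).trans (Real.exp_le_exp.2 ?_)
    rw [norm_mul]
    refine (mul_le_mul h8 h7 (norm_nonneg _) (by positivity)).trans ?_
    rw [← hC₁]
    have h9 : c * V.re ^ 2 ≤ c * X₀ ^ 2 := by
      rw [← sq_abs]
      gcongr
    have h10 : 0 ≤ Real.pi * (c + C) * (1 + |V.re|) := by positivity
    have h11 : 0 ≤ (C₁ + c * X₀ ^ 2) * |V.re| := by positivity
    linarith

/-- The Gaussian factor beats the constant `e^{|z|² / 6}` of Cauchy's estimate, because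
`|z|² = π |V|²` and `π / 6 < π / 2`. -/
theorem norm_exp_mul_sq_le (V : ℂ) (hV : |V.im| ≤ 1) :
    ‖exp ((Real.pi : ℂ) * I / 2 * (dir * V) ^ 2)‖ *
      Real.exp (‖I * (Real.sqrt Real.pi : ℂ) * (dir * V)‖ ^ 2 / 6) ≤
      Real.exp (3 - V.re ^ 2) := by
  have hpi := Real.pi_gt_three
  have hpi2 := Real.pi_lt_d2
  have h1 : ‖I * (Real.sqrt Real.pi : ℂ) * (dir * V)‖ ^ 2 = Real.pi * (V.re ^ 2 + V.im ^ 2) := by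
    rw [norm_mul, norm_mul, norm_mul, norm_dir, norm_I, norm_real,
      Real.norm_of_nonneg (Real.sqrt_nonneg _), one_mul, one_mul, mul_pow,
      Real.sq_sqrt Real.pi_pos.le, ← normSq_eq_norm_sq, normSq_apply]
    ring
  have h2 : (Real.pi : ℂ) * I / 2 * (dir * V) ^ 2 = ((-(Real.pi / 2) : ℝ) : ℂ) * (V * V) := by
    push_cast
    linear_combination (Real.pi * I / 2 * V ^ 2 : ℂ) * dir_sq + (Real.pi / 2 * V ^ 2 : ℂ) * I_sq
  rw [h1, h2, norm_exp, ← Real.exp_add, re_ofReal_mul, mul_re]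
  apply Real.exp_le_exp.2
  have h8 : V.im ^ 2 ≤ 1 := (sq_le_one_iff_abs_le_one _).2 hV
  nlinarith [sq_nonneg V.re, sq_nonneg V.im]

/-- The `n`-th remainder of the Taylor expansion of `g`, multiplied by the Gaussian factor. -/
noncomputable def gaussRem (n : ℕ) (a y : ℂ) : ℂ :=
  exp ((Real.pi : ℂ) * I / 2 * y ^ 2) *
    (g (-(1 / (4 * (Real.sqrt Real.pi : ℂ))) / a) (I * (Real.sqrt Real.pi : ℂ) * y) -
      ∑ k ∈ Finset.range n, P k (I * (Real.sqrt Real.pi : ℂ) * y) *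
        (-(1 / (4 * (Real.sqrt Real.pi : ℂ))) / a) ^ k)

/-- The Taylor remainder, weighted by the Gaussian factor, is of order `|a|^{-n}` with Gaussian decay.
The two cases are separated by the ratio `ρ` of `|τ|` to the radius of Cauchy's estimate. -/
theorem exists_gaussRem_bound {δ : ℝ} (hδ : 0 < δ) (n : ℕ) :
    ∃ c > 0, ∃ A > 0, ∀ a V : ℂ, 1 ≤ ‖a‖ → δ * ‖a‖ ≤ a.re - a.im → |V.im| ≤ 1 →
      1 / 2 ≤ (a + dir * V / 2).re - (a + dir * V / 2).im →
      ‖gaussRem n a (dir * V)‖ ≤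
        Real.exp (A * (1 + |V.re|) - c * V.re ^ 2) * (1 / ‖a‖ ^ n) := by
  obtain ⟨c, hc, C, hC, hU⟩ := exists_exp_phase_bound hδ
  set N : ℝ := 2 + (1 + n) * 2 ^ n with hN
  refine ⟨min c 1, by positivity, C + 3 + n + N, by positivity, ?_⟩
  intro a V ha hcone hV hx
  have ha0 : a ≠ 0 := norm_pos_iff.1 (by linarith)
  have hN0 : 0 < N := by positivity
  set r := Real.sqrt Real.pi with hr
  have hr1 : 1 ≤ r := by
    rw [hr, Real.one_le_sqrt]; linarith [Real.pi_gt_three]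
  set τ : ℂ := -(1 / (4 * (r : ℂ))) / a with hτ
  set z : ℂ := I * (r : ℂ) * (dir * V) with hz
  have hτn : ‖τ‖ = 1 / (4 * r * ‖a‖) := by
    rw [hτ, norm_div, norm_neg, norm_div, norm_mul, norm_real, Real.norm_of_nonneg (by linarith)]
    simp
    ring
  have hzn : ‖z‖ = r * ‖V‖ := by
    rw [hz, norm_mul, norm_mul, norm_mul, norm_dir, norm_I, norm_real,
      Real.norm_of_nonneg (by linarith), one_mul, one_mul]
  have hVX' : ‖V‖ ≤ |V.re| + 1 := norm_le_add_of_im hV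
  set ρ := 4 * ‖τ‖ * (‖z‖ + 1) with hρ
  have hρ0 : 0 ≤ ρ := by positivity
  have hρe : ρ = (‖V‖ + 1 / r) / ‖a‖ := by
    rw [hρ, hτn, hzn]; field_simp
  have hri : 1 / r ≤ 1 := by rw [div_le_one (by linarith)]; exact hr1
  have hρle : ρ ^ n ≤ Real.exp (n * (1 + |V.re|)) * (1 / ‖a‖ ^ n) := by
    have h1 : ρ ≤ Real.exp (1 + |V.re|) / ‖a‖ := by
      rw [hρe]
      gcongr
      have := Real.add_one_le_exp (1 + |V.re|)
      linarith
    calc ρ ^ n ≤ (Real.exp (1 + |V.re|) / ‖a‖) ^ n := by gcongr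
      _ = _ := by rw [div_pow, ← Real.exp_nat_mul]; ring
  have hgauss := norm_exp_mul_sq_le V hV
  rw [← hr, ← hz] at hgauss
  set G := Real.exp (C * (1 + |V.re|) + 3 - min c 1 * V.re ^ 2) with hG
  have hG1 : Real.exp (3 - V.re ^ 2) ≤ G := by
    apply Real.exp_le_exp.2
    have h1 : min c 1 * V.re ^ 2 ≤ 1 * V.re ^ 2 := by gcongr; exact min_le_right _ _
    have h2 : 0 ≤ C * (1 + |V.re|) := by positivity
    linarith
  have hG2 : Real.exp (C * (1 + |V.re|) - c * V.re ^ 2) ≤ G := by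
    apply Real.exp_le_exp.2
    have h1 : min c 1 * V.re ^ 2 ≤ c * V.re ^ 2 := by gcongr; exact min_le_left _ _
    linarith
  have hG0 : 0 < G := Real.exp_pos _
  have main : ‖gaussRem n a (dir * V)‖ ≤ N * G * ρ ^ n := by
    rw [gaussRem, ← hr, ← hτ, ← hz]
    rcases le_or_gt ρ (1 / 2) with h | h
    · have h1 := norm_g_sub_sum_le (τ := τ) (z := z) n h
      rw [norm_mul]
      calc _ ≤ ‖exp ((Real.pi : ℂ) * I / 2 * (dir * V) ^ 2)‖ *
            (2 * Real.exp (‖z‖ ^ 2 / 6) * ρ ^ n) := by gcongr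
        _ = 2 * (‖exp ((Real.pi : ℂ) * I / 2 * (dir * V) ^ 2)‖ *
            Real.exp (‖z‖ ^ 2 / 6)) * ρ ^ n := by ring
        _ ≤ N * G * ρ ^ n := by
            gcongr
            · rw [hN]; have : (0 : ℝ) ≤ (1 + n) * 2 ^ n := by positivity
              linarith
            · exact hgauss.trans hG1
    · have h2ρ : 1 ≤ 2 * ρ := by linarith
      -- Here `(2ρ)^n ≥ 1`, so the factor `ρ^n` may be inserted freely.
      have hreg : ‖a‖ ≤ 2 * |V.re| + 4 := by
        rw [hρe, lt_div_iff₀ (by linarith)] at h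
        linarith
      have hg := hU a V ha hcone hV hx hreg
      rw [← exp_mul_g ha0, ← hr, ← hτ, ← hz] at hg
      have hsum : ‖exp ((Real.pi : ℂ) * I / 2 * (dir * V) ^ 2) *
          ∑ k ∈ Finset.range n, P k z * τ ^ k‖ ≤ n * (G * (2 * ρ) ^ n) := by
        rw [Finset.mul_sum]
        refine (norm_sum_le _ _).trans ?_
        refine (Finset.sum_le_card_nsmul _ _ (G * (2 * ρ) ^ n) fun k hk => ?_).trans
          (by rw [Finset.card_range, nsmul_eq_mul])
        rw [norm_mul, norm_mul, norm_pow]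
        have hk' : k ≤ n := (Finset.mem_range.1 hk).le
        calc _ ≤ ‖exp ((Real.pi : ℂ) * I / 2 * (dir * V) ^ 2)‖ *
              (Real.exp (‖z‖ ^ 2 / 6) * (4 * (‖z‖ + 1)) ^ k * ‖τ‖ ^ k) := by
                gcongr; exact norm_P_le _ _
          _ = ‖exp ((Real.pi : ℂ) * I / 2 * (dir * V) ^ 2)‖ *
              Real.exp (‖z‖ ^ 2 / 6) * ρ ^ k := by
                rw [hρ, mul_assoc (Real.exp _), ← mul_pow]; ring
          _ ≤ G * (2 * ρ) ^ n := by
                gcongr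
                · exact hgauss.trans hG1
                · calc ρ ^ k ≤ (2 * ρ) ^ k := by gcongr; linarith
                    _ ≤ (2 * ρ) ^ n := pow_le_pow_right₀ h2ρ hk'
      rw [mul_sub]
      refine (norm_sub_le _ _).trans ((add_le_add (hg.trans hG2) hsum).trans ?_)
      have h3 : 1 ≤ (2 * ρ) ^ n := one_le_pow₀ h2ρ
      have h4 : G ≤ G * (2 * ρ) ^ n := le_mul_of_one_le_right hG0.le h3
      calc G + n * (G * (2 * ρ) ^ n) ≤ (1 + n) * (G * (2 * ρ) ^ n) := by linarith
        _ = (1 + n) * 2 ^ n * G * ρ ^ n := by rw [mul_pow]; ring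
        _ ≤ N * G * ρ ^ n := by gcongr; rw [hN]; linarith
  refine main.trans ?_
  have hNe : N ≤ Real.exp (N * (1 + |V.re|)) := by
    have h1 := Real.add_one_le_exp (N * (1 + |V.re|))
    have h2 : 0 ≤ N * |V.re| := by positivity
    linarith
  calc N * G * ρ ^ n ≤ Real.exp (N * (1 + |V.re|)) * G *
        (Real.exp (n * (1 + |V.re|)) * (1 / ‖a‖ ^ n)) := by gcongr
    _ = Real.exp (N * (1 + |V.re|) + (C * (1 + |V.re|) + 3 - min c 1 * V.re ^ 2) +
        n * (1 + |V.re|)) * (1 / ‖a‖ ^ n) := by rw [Real.exp_add, Real.exp_add, hG]; ring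
    _ ≤ _ := by
        gcongr
        have : 0 ≤ |V.re| := abs_nonneg _
        linarith

/-! ### The remainder integrals -/

theorem exp_le_norm_two_cos (u : ℝ) :
    Real.exp (Real.pi / (2 * Real.sqrt 2) * |u|) ≤
      2 * ‖2 * cos ((Real.pi : ℂ) * (u * dir) / 2)‖ := by
  set b := Real.pi / (2 * Real.sqrt 2) with hb
  have hs := Real.mul_self_sqrt (show (0 : ℝ) ≤ 2 by norm_num)
  have hs0 : 0 < Real.sqrt 2 := by positivity
  have hb0 : 0 < b := by have := Real.pi_pos; positivity
  have hb' : Real.pi * (Real.sqrt 2 / 2) / 2 = b := by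
    rw [hb]; field_simp; linarith
  set s := b * u with hsdef
  have harg : (Real.pi : ℂ) * (u * dir) / 2 = -((s : ℂ) + s * I) := by
    rw [dir_eq, hsdef, ← hb']; push_cast; ring
  have hcos : cos ((s : ℂ) + s * I) = ((Real.cos s * Real.cosh s : ℝ) : ℂ) +
      ((-(Real.sin s * Real.sinh s) : ℝ) : ℂ) * I := by
    rw [cos_add, cos_mul_I, sin_mul_I]; push_cast; ring
  have hN : ‖cos ((s : ℂ) + s * I)‖ ^ 2 = Real.cos s ^ 2 + Real.sinh s ^ 2 := by
    rw [← normSq_eq_norm_sq, hcos, normSq_add_mul_I, mul_pow, Real.cosh_sq, neg_sq, mul_pow]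
    linear_combination Real.sinh s ^ 2 * Real.sin_sq_add_cos_sq s
  have habs : b * |u| = |s| := by rw [hsdef, abs_mul, abs_of_pos hb0]
  rw [harg, cos_neg, norm_mul, norm_ofNat, habs, ← sq_le_sq₀ (Real.exp_pos _).le (by positivity),
    ← Real.exp_nat_mul]
  have h1 : Real.exp ((2 : ℕ) * |s|) ≤ 2 + 4 * Real.sinh s ^ 2 := by
    have h2 := Real.cosh_two_mul |s|
    rw [Real.cosh_sq, ← Real.abs_sinh, sq_abs] at h2
    have h3 := Real.cosh_eq (2 * |s|)
    have h4 := Real.exp_pos (-(2 * |s|))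
    push_cast
    linarith
  have h5 : s ^ 2 ≤ Real.sinh s ^ 2 := by
    rw [sq_le_sq, Real.abs_sinh]
    exact Real.self_le_sinh_iff.2 (abs_nonneg _)
  have h6 : Real.sin s ^ 2 ≤ s ^ 2 := sq_le_sq.2 Real.abs_sin_le_abs
  have h7 := Real.sin_sq_add_cos_sq s
  have h8 : (2 * (2 * ‖cos ((s : ℂ) + s * I)‖)) ^ 2 =
      16 * (Real.cos s ^ 2 + Real.sinh s ^ 2) := by rw [← hN]; ring
  rw [h8]
  refine h1.trans ?_
  rcases le_or_gt (s ^ 2) 1 with h | h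
  · linarith
  · linarith [sq_nonneg (Real.cos s)]

/-- Points of the line of integration relative to `q`, in coordinates rotated by `dir`: the first
coordinate of `-q` is `mu q`. -/
theorem sub_eq_dir_mul (u : ℝ) (q : ℂ) :
    (u : ℂ) * dir - q = dir * (((u + mu q : ℝ) : ℂ) + (((q.im - q.re) / Real.sqrt 2 : ℝ) : ℂ) * I) := by
  apply Complex.ext
  · rw [dir_mul_re, sub_re, re_ofReal_mul, dir_re, mu]
    simp
    field_simp
    ring
  · rw [dir_mul_im, sub_im, im_ofReal_mul, dir_im, mu]
    simp
    field_simp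
    ring

theorem integrable_exp_abs_sub_sq (B : ℝ) {c : ℝ} (hc : 0 < c) :
    MeasureTheory.Integrable fun x : ℝ => Real.exp (B * |x| - c * x ^ 2) := by
  have h : MeasureTheory.Integrable fun x : ℝ =>
      Real.exp (B ^ 2 / (2 * c)) * Real.exp (-(c / 2) * x ^ 2) :=
    (integrable_exp_neg_mul_sq (by positivity)).const_mul _
  refine h.mono' (by fun_prop) (Filter.Eventually.of_forall fun x => ?_)
  rw [Real.norm_of_nonneg (Real.exp_pos _).le, ← Real.exp_add]
  apply Real.exp_le_exp.2
  have h1 : 0 ≤ (B - c * |x|) ^ 2 / (2 * c) := by positivity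
  have h2 : (B - c * |x|) ^ 2 / (2 * c) = B ^ 2 / (2 * c) - B * |x| + c / 2 * x ^ 2 := by
    rw [← sq_abs x]; field_simp; ring
  linarith

/-- The conditions on the saddle point `a` and the parameter `q` under which the remainder is
estimated: `a` lies in a closed sector, and the line of integration stays within a bounded distance
of `a` and away from the origin. -/
structure Admissible (δ : ℝ) (a q : ℂ) : Prop where
  one_le : 1 ≤ ‖a‖
  cone : δ * ‖a‖ ≤ a.re - a.im
  near : |q.re - q.im| ≤ 1
  away : 1 / 2 ≤ (a - q / 2).re - (a - q / 2).im

/-- The integrand of the `n`-th remainder. -/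
noncomputable def remKernel (n : ℕ) (a q v : ℂ) : ℂ :=
  gaussRem n a (v - q) / (2 * cos ((Real.pi : ℂ) * v / 2))

theorem measurable_remKernel (n : ℕ) (a q : ℂ) : Measurable (remKernel n a q) := by
  have h1 : Measurable fun v : ℂ => I * (Real.sqrt Real.pi : ℂ) * (v - q) := by fun_prop
  have h2 : Measurable fun v : ℂ => exp ((Real.pi : ℂ) * I / 2 * (v - q) ^ 2) := by fun_prop
  have h3 : Measurable fun v : ℂ => 2 * cos ((Real.pi : ℂ) * v / 2) := by fun_prop
  refine (h2.mul (((measurable_g _).comp h1).sub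
    (Finset.measurable_fun_sum _ fun k _ => ?_))).div h3
  exact ((measurable_P k).comp h1).mul_const _

theorem exists_remKernel_bound {δ : ℝ} (hδ : 0 < δ) (n : ℕ) :
    ∃ c > 0, ∃ A B : ℝ, ∀ a q : ℂ, Admissible δ a q → ∀ u : ℝ,
      ‖remKernel n a q (u * dir)‖ ≤
        Real.exp (-(Real.pi / (2 * Real.sqrt 2)) * |mu q|) * (1 / ‖a‖ ^ n) *
          (A * Real.exp (B * |u + mu q| - c * (u + mu q) ^ 2)) := by
  obtain ⟨c, hc, A, hA, h⟩ := exists_gaussRem_bound hδ n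
  set b := Real.pi / (2 * Real.sqrt 2) with hb
  have hb0 : 0 < b := by have := Real.pi_pos; positivity
  refine ⟨c, hc, 2 * Real.exp A, A + b, fun a q hq u => ?_⟩
  set V : ℂ := ((u + mu q : ℝ) : ℂ) + (((q.im - q.re) / Real.sqrt 2 : ℝ) : ℂ) * I with hV
  have hVre : V.re = u + mu q := by simp [hV]
  have hVim : |V.im| ≤ 1 := by
    have : V.im = (q.im - q.re) / Real.sqrt 2 := by simp [hV]
    rw [this, abs_div, abs_of_pos (by positivity : 0 < Real.sqrt 2), div_le_one (by positivity),
      abs_sub_comm]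
    linarith [hq.near, sqrt_two_bounds.1]
  have hy : (u : ℂ) * dir - q = dir * V := sub_eq_dir_mul u q
  have hx : 1 / 2 ≤ (a + dir * V / 2).re - (a + dir * V / 2).im := by
    have e : a + dir * V / 2 = (a - q / 2) + ((u / 2 : ℝ) : ℂ) * dir := by
      rw [← hy]; push_cast; ring
    rw [e, add_re, add_im, re_ofReal_mul, im_ofReal_mul, dir_re, dir_im]
    linarith [hq.away]
  have h1 := h a V hq.one_le hq.cone hVim hx
  rw [hVre] at h1
  have h2 := exp_le_norm_two_cos u
  have h3 : 0 < ‖2 * cos ((Real.pi : ℂ) * (u * dir) / 2)‖ := by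
    have := Real.exp_pos (b * |u|); linarith
  rw [remKernel, hy, norm_div, div_le_iff₀ h3]
  refine h1.trans ?_
  have h4 : |mu q| ≤ |u| + |u + mu q| := by
    have := abs_sub (u + mu q) u
    rw [add_sub_cancel_left] at this
    linarith
  have h5 : Real.exp (A * (1 + |u + mu q|) - c * (u + mu q) ^ 2) ≤
      Real.exp (-b * |mu q|) * (Real.exp A * Real.exp ((A + b) * |u + mu q| - c * (u + mu q) ^ 2)) *
        Real.exp (b * |u|) := by
    rw [← Real.exp_add, ← Real.exp_add, ← Real.exp_add]
    apply Real.exp_le_exp.2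
    have := mul_le_mul_of_nonneg_left h4 hb0.le
    linarith
  have ha : 0 < 1 / ‖a‖ ^ n := by
    have := hq.one_le; positivity
  calc _ ≤ Real.exp (-b * |mu q|) *
        (Real.exp A * Real.exp ((A + b) * |u + mu q| - c * (u + mu q) ^ 2)) *
        (2 * ‖2 * cos ((Real.pi : ℂ) * (u * dir) / 2)‖) * (1 / ‖a‖ ^ n) := by
        gcongr
        exact h5.trans (by gcongr)
    _ = _ := by ring

theorem integrable_remKernel {δ : ℝ} (hδ : 0 < δ) (n : ℕ) {a q : ℂ} (h : Admissible δ a q) :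
    MeasureTheory.Integrable fun u : ℝ => remKernel n a q (u * dir) * dir := by
  obtain ⟨c, hc, A, B, hb⟩ := exists_remKernel_bound hδ n
  refine MeasureTheory.Integrable.mul_const ?_ _
  have h1 := (((integrable_exp_abs_sub_sq B hc).comp_add_right (mu q)).const_mul A).const_mul
    (Real.exp (-(Real.pi / (2 * Real.sqrt 2)) * |mu q|) * (1 / ‖a‖ ^ n))
  refine h1.mono' ?_ (Filter.Eventually.of_forall fun u => hb a q h u)
  exact ((measurable_remKernel n a q).comp (by fun_prop)).aestronglyMeasurable

/-- Consecutive remainders differ by one term of the expansion. -/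
theorem lineIntegral_remKernel_step {δ : ℝ} (hδ : 0 < δ) (n : ℕ) {a q : ℂ}
    (h : Admissible δ a q) :
    lineIntegral 0 (remKernel n a q) = D n q / a ^ n + lineIntegral 0 (remKernel (n + 1) a q) := by
  rw [← sub_eq_iff_eq_add, D, lineIntegral_eq, lineIntegral_eq, lineIntegral_eq]
  simp only [zero_add]
  rw [← MeasureTheory.integral_sub (integrable_remKernel hδ n h)
    (integrable_remKernel hδ (n + 1) h), mul_div_right_comm, ← div_pow,
    ← MeasureTheory.integral_const_mul]
  congr 1
  funext u
  rw [remKernel, remKernel, gaussRem, gaussRem, Finset.sum_range_succ]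
  ring

theorem lineIntegral_remKernel_zero {δ : ℝ} (hδ : 0 < δ) (n : ℕ) {a q : ℂ}
    (h : Admissible δ a q) :
    lineIntegral 0 (remKernel 0 a q) =
      ∑ k ∈ Finset.range n, D k q / a ^ k + lineIntegral 0 (remKernel n a q) := by
  induction n with
  | zero => simp
  | succ n ih =>
    rw [ih, lineIntegral_remKernel_step hδ n h, Finset.sum_range_succ, add_assoc]

theorem exists_norm_lineIntegral_remKernel_le {δ : ℝ} (hδ : 0 < δ) (n : ℕ) :
    ∃ C : ℝ, ∀ a q : ℂ, Admissible δ a q →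
      ‖lineIntegral 0 (remKernel n a q)‖ ≤
        C * (Real.exp (-(Real.pi / (2 * Real.sqrt 2)) * |mu q|) * (1 / ‖a‖ ^ n)) := by
  obtain ⟨c, hc, A, B, hb⟩ := exists_remKernel_bound hδ n
  refine ⟨A * ∫ x : ℝ, Real.exp (B * |x| - c * x ^ 2), fun a q h => ?_⟩
  have h1 := (((integrable_exp_abs_sub_sq B hc).comp_add_right (mu q)).const_mul A).const_mul
    (Real.exp (-(Real.pi / (2 * Real.sqrt 2)) * |mu q|) * (1 / ‖a‖ ^ n))
  rw [lineIntegral_eq]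
  simp only [zero_add]
  refine (MeasureTheory.norm_integral_le_of_norm_le h1 (Filter.Eventually.of_forall fun u => by
    rw [norm_mul, norm_dir, mul_one]; exact hb a q h u)).trans (le_of_eq ?_)
  rw [MeasureTheory.integral_const_mul, MeasureTheory.integral_const_mul,
    MeasureTheory.integral_add_right_eq_self (fun x : ℝ => Real.exp (B * |x| - c * x ^ 2))]
  ring

/-- Factoring out the value at the saddle point turns the integral of `kernel` along the line
through `m + 1/2` into the remainder integral of order `0`. -/
theorem lineIntegral_kernel_eq {a : ℂ} (ha : 0 < a.re - a.im) (m : ℕ) :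
    lineIntegral ((m : ℂ) + 1 / 2) (kernel (2 * Real.pi * I * a ^ 2)) =
      (-1) ^ m / (2 * I) * a ^ (-(2 * Real.pi * I * a ^ 2)) * exp ((Real.pi : ℂ) * I * a ^ 2) *
        lineIntegral 0 (remKernel 0 a (2 * a - 2 * m - 1)) := by
  have ha0 : a ≠ 0 := fun h => by rw [h] at ha; simp at ha
  set w := 2 * Real.pi * I * a ^ 2 with hw
  rw [lineIntegral_eq, lineIntegral_eq]
  have hscale := MeasureTheory.Measure.integral_comp_div
    (fun u : ℝ => kernel w ((m : ℂ) + 1 / 2 + u * dir) * dir) 2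
  rw [abs_of_pos (by norm_num : (0 : ℝ) < 2), real_smul] at hscale
  have hscale' : ∫ u : ℝ, kernel w ((m : ℂ) + 1 / 2 + u * dir) * dir =
      ∫ u : ℝ, 1 / 2 * (kernel w ((m : ℂ) + 1 / 2 + (u / 2 : ℝ) * dir) * dir) := by
    rw [MeasureTheory.integral_const_mul, hscale]; push_cast; ring
  rw [hscale', ← MeasureTheory.integral_const_mul]
  congr 1
  funext u
  set v : ℂ := u * dir with hv
  set x : ℂ := (m : ℂ) + 1 / 2 + (u / 2 : ℝ) * dir with hx
  have hxv : x = (m : ℂ) + 1 / 2 + v / 2 := by rw [hx, hv]; push_cast; ring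
  have hxh : 0 < x.re - x.im := by
    rw [hx, add_re, add_im, re_ofReal_mul, im_ofReal_mul, dir_re, dir_im]
    simp
    positivity
  have hx0 : x ≠ 0 := fun h => by rw [h] at hxh; simp at hxh
  set y : ℂ := v - (2 * a - 2 * m - 1) with hy
  have hxy : 1 + y / (2 * a) = x / a := by rw [hxv, hy]; field_simp; ring
  have hpow : x ^ (-w) * exp ((Real.pi : ℂ) * I * x ^ 2) =
      a ^ (-w) * exp ((Real.pi : ℂ) * I * a ^ 2) *
        exp (-w * (log (1 + y / (2 * a)) - y / (2 * a) - (y / (2 * a)) ^ 2 / 2)) := by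
    rw [hxy, log_div_of_halfPlane hxh ha, cpow_def_of_ne_zero hx0, cpow_def_of_ne_zero ha0,
      ← exp_add, ← exp_add, ← exp_add]
    congr 1
    have h1 : y = 2 * (x - a) := by rw [hy, hxv]; ring
    rw [h1, hw]
    field_simp
    ring
  have hsin : sin ((Real.pi : ℂ) * x) = (-1) ^ m * cos ((Real.pi : ℂ) * v / 2) := by
    have h1 : (Real.pi : ℂ) * x = ((Real.pi : ℂ) * v / 2 + Real.pi / 2) + m * Real.pi := by
      rw [hxv]; ring
    rw [h1, sin_antiperiodic.add_nat_mul_eq, sin_add_pi_div_two]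
  have hm : ((-1 : ℂ) ^ m) * (-1) ^ m = 1 := by
    rw [← mul_pow]; simp
  have hinv : ((-1 : ℂ) ^ m)⁻¹ = (-1) ^ m := inv_eq_of_mul_eq_one_left hm
  simp only [zero_add]
  rw [kernel, exp_sub_exp_eq_sin, hsin, hpow, remKernel, gaussRem, Finset.range_zero,
    Finset.sum_empty, sub_zero, ← hy, exp_mul_g ha0, ← hw]
  simp only [div_eq_mul_inv, mul_inv, hinv]
  ring

/-- The conjugated form of the expansion. -/
theorem exists_expansion {δ : ℝ} (hδ : 0 < δ) (n : ℕ) :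
    ∃ C : ℝ, ∀ (a : ℂ) (m : ℕ), Admissible δ a (2 * a - 2 * m - 1) → ∃ E : ℂ,
      ‖E‖ ≤ C * (Real.exp (-(Real.pi / (2 * Real.sqrt 2)) * |mu (2 * a - 2 * m - 1)|) *
        (1 / ‖a‖ ^ n)) ∧
      auxR (2 * Real.pi * I * a ^ 2) =
        ∑ j ∈ Finset.Icc 1 m, (j : ℂ) ^ (-(2 * Real.pi * I * a ^ 2)) +
          (-1) ^ m / (2 * I) * a ^ (-(2 * Real.pi * I * a ^ 2)) *
            exp ((Real.pi : ℂ) * I * a ^ 2) *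
            (∑ k ∈ Finset.range n, D k (2 * a - 2 * m - 1) / a ^ k + E) := by
  obtain ⟨C, hC⟩ := exists_norm_lineIntegral_remKernel_le hδ n
  refine ⟨C, fun a m h => ⟨_, hC a _ h, ?_⟩⟩
  have ha : 0 < a.re - a.im := lt_of_lt_of_le (by have := h.one_le; positivity) h.cone
  rw [auxR_eq_sum_add _ m, lineIntegral_kernel_eq ha, lineIntegral_remKernel_zero hδ n h]

/-! ### The saddle point -/

theorem one_le_norm_eta {s : ℂ} (h : 2 * Real.pi ≤ ‖1 - s‖) : 1 ≤ ‖eta s‖ := by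
  have hpi := Real.pi_pos
  have hs : s ≠ 1 := fun h0 => by rw [h0] at h; simp at h; linarith
  have h1 : ‖eta s‖ ^ 2 = ‖1 - s‖ / (2 * Real.pi) := by
    rw [← norm_pow, eta_sq s hs, norm_div, norm_sub_rev s 1, norm_mul, norm_mul, norm_I,
      norm_real, Real.norm_of_nonneg hpi.le, norm_ofNat, mul_one]
  have h2 : 1 ≤ ‖eta s‖ ^ 2 := by rw [h1, le_div_iff₀ (by positivity)]; linarith
  exact (one_le_sq_iff₀ (norm_nonneg _)).1 h2

/-- The argument of `eta s` stays at distance `θ / 2` from the ends of `(-π/4, 3π/4)`. -/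
theorem sin_half_mul_norm_le_eta {θ : ℝ} (hθ₀ : 0 < θ) (hθ₁ : θ < Real.pi) {s : ℂ}
    (h : 1 - s ∈ Delta θ) :
    Real.sin (θ / 2) * ‖eta s‖ ≤ (eta s).re + (eta s).im := by
  obtain ⟨h1, h2, h3⟩ := h
  have hpi := Real.pi_pos
  set φ := (arg (1 - s) + Real.pi / 2) / 2 with hφ
  have harg : arg ((1 - s) / (2 * (Real.pi : ℂ))) = arg (1 - s) := by
    have : (1 - s) / (2 * (Real.pi : ℂ)) = ((1 / (2 * Real.pi) : ℝ) : ℂ) * (1 - s) := by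
      push_cast; ring
    rw [this, arg_real_mul _ (by positivity)]
  set e : ℂ := (log ((1 - s) / (2 * (Real.pi : ℂ))) + (Real.pi : ℂ) / 2 * I) / 2 with he
  have him : e.im = φ := by simp [he, log_im, harg, hφ]
  have heta : eta s = exp e := rfl
  rw [heta, norm_exp, exp_re, exp_im, him, ← mul_add, mul_comm]
  refine mul_le_mul_of_nonneg_left ?_ (Real.exp_pos _).le
  have h4 : Real.sin (θ / 2) ≤ Real.sin (φ + Real.pi / 4) := by
    rcases le_or_gt (φ + Real.pi / 4) (Real.pi / 2) with h | h
    · exact Real.sin_le_sin_of_le_of_le_pi_div_two (by linarith) h (by linarith)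
    · rw [← Real.sin_pi_sub (φ + Real.pi / 4)]
      exact Real.sin_le_sin_of_le_of_le_pi_div_two (by linarith) (by linarith) (by linarith)
  have h5 : 0 ≤ Real.sin (θ / 2) := Real.sin_nonneg_of_nonneg_of_le_pi (by linarith) (by linarith)
  rw [Real.sin_add, Real.cos_pi_div_four, Real.sin_pi_div_four] at h4
  have := sqrt_two_bounds
  nlinarith

theorem admissible_eta {θ : ℝ} (hθ₀ : 0 < θ) (hθ₁ : θ < Real.pi) {s : ℂ} (h : 1 - s ∈ Delta θ) :
    Admissible (Real.sin (θ / 2)) ((starRingEnd ℂ) (eta s))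
      (2 * (starRingEnd ℂ) (eta s) - 2 * m s - 1) := by
  have hcone := sin_half_mul_norm_le_eta hθ₀ hθ₁ h
  have hsin : 0 < Real.sin (θ / 2) := Real.sin_pos_of_pos_of_lt_pi (by linarith) (by linarith)
  have h0 : 0 ≤ (eta s).re + (eta s).im := le_trans (by positivity) hcone
  have h1 : (m s : ℝ) ≤ (eta s).re + (eta s).im := Nat.floor_le h0
  have h2 : (eta s).re + (eta s).im < m s + 1 := Nat.lt_floor_add_one _
  refine ⟨?_, ?_, ?_, ?_⟩
  · rw [norm_conj]; exact one_le_norm_eta h.2.2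
  · rw [norm_conj, conj_re, conj_im]; linarith
  · rw [abs_le]
    simp
    constructor <;> linarith
  · have e : (starRingEnd ℂ) (eta s) - (2 * (starRingEnd ℂ) (eta s) - 2 * m s - 1) / 2 =
        (((m s : ℝ) + 1 / 2 : ℝ) : ℂ) := by push_cast; ring
    rw [e, ofReal_re, ofReal_im]
    have : (0 : ℝ) ≤ m s := Nat.cast_nonneg _
    linarith

end RiemannAux

theorem mainTheorem2 (θ : ℝ) (hθ₀ : 0 < θ) (hθ₁ : θ < Real.pi) (K : ℕ) (hK : 1 ≤ K) :
    ∃ C : ℝ, ∀ s : ℂ, 1 - s ∈ RiemannAux.Delta θ →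
      ∃ E : ℂ,
        ‖E‖ ≤ C * (Real.exp (-(Real.pi / (2 * Real.sqrt 2)) *
            |RiemannAux.mu ((starRingEnd ℂ) (RiemannAux.p s))|) *
          (1 / ‖RiemannAux.eta s‖ ^ (K + 1))) ∧
        RiemannAux.conjFun RiemannAux.auxR (1 - s) =
          ∑ n ∈ Finset.Icc 1 (RiemannAux.m s), (n : ℂ) ^ (s - 1) -
            (-1 : ℂ) ^ RiemannAux.m s / (2 * Complex.I) *
              RiemannAux.eta s ^ (s - 1) *
              Complex.exp (-((Real.pi : ℂ) * Complex.I * RiemannAux.eta s ^ 2)) *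
              (∑ k ∈ Finset.range (K + 1),
                  RiemannAux.conjFun (RiemannAux.D k) (RiemannAux.p s) / RiemannAux.eta s ^ k
                + E) := by
  have hsin : 0 < Real.sin (θ / 2) := Real.sin_pos_of_pos_of_lt_pi (by linarith) (by linarith)
  obtain ⟨C, hC⟩ := RiemannAux.exists_expansion hsin (K + 1)
  refine ⟨C, fun s hs => ?_⟩
  have hadm := RiemannAux.admissible_eta hθ₀ hθ₁ hs
  set η := RiemannAux.eta s with hη
  set m := RiemannAux.m s with hm
  set a := (starRingEnd ℂ) η with ha
  have hpi : (Real.pi : ℂ) ≠ 0 := by exact_mod_cast Real.pi_ne_zero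
  have hs1 : s ≠ 1 := fun h0 => by
    have := hs.2.2
    rw [h0] at this
    simp at this
    linarith [Real.pi_pos]
  have hη2 : 2 * Real.pi * Complex.I * η ^ 2 = s - 1 := by
    have := Complex.I_ne_zero
    rw [hη, RiemannAux.eta_sq s hs1]; field_simp
  have hca : (starRingEnd ℂ) a = η := Complex.conj_conj η
  have hw : 2 * Real.pi * Complex.I * a ^ 2 = (starRingEnd ℂ) (1 - s) := by
    have := congrArg (starRingEnd ℂ) hη2
    simp only [map_mul, map_pow, map_sub, map_one, map_ofNat, Complex.conj_I,
      Complex.conj_ofReal, ← ha] at this ⊢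
    linear_combination -this
  have hq : 2 * a - 2 * m - 1 = (starRingEnd ℂ) (RiemannAux.p s) := by
    simp only [RiemannAux.p, map_mul, map_sub, map_add, map_neg, map_div₀, map_one, map_ofNat,
      map_natCast, ← hη, ← ha, ← hm]
    ring
  obtain ⟨E, hE, hR⟩ := hC a m hadm
  rw [hq, hw] at hR
  rw [hq, ha, RCLike.norm_conj] at hE
  refine ⟨(starRingEnd ℂ) E, by rw [RCLike.norm_conj]; exact hE, ?_⟩
  have haarg : a.arg ≠ Real.pi := by
    have h0 : 0 < a.re - a.im :=
      lt_of_lt_of_le (by have := hadm.one_le; positivity) hadm.cone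
    intro h
    rw [Complex.arg_eq_pi_iff] at h
    linarith [h.1, h.2]
  have hexp : (starRingEnd ℂ) (-(starRingEnd ℂ) (1 - s)) = s - 1 := by simp
  have hconjpow : ∀ x : ℂ, x.arg ≠ Real.pi →
      (starRingEnd ℂ) (x ^ (-(starRingEnd ℂ) (1 - s))) = (starRingEnd ℂ) x ^ (s - 1) := by
    intro x hx
    rw [Complex.conj_cpow _ _ hx, ← hexp, Complex.conj_conj]
  rw [RiemannAux.conjFun, hR]
  simp only [map_add, map_mul, map_sum, map_div₀, map_pow, map_neg, map_one, map_ofNat,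
    Complex.conj_I, ← Complex.exp_conj, Complex.conj_ofReal, hconjpow a haarg, hca]
  have hsum : ∑ x ∈ Finset.Icc 1 m, (starRingEnd ℂ) ((x : ℂ) ^ (-(starRingEnd ℂ) (1 - s))) =
      ∑ n ∈ Finset.Icc 1 m, (n : ℂ) ^ (s - 1) := by
    refine Finset.sum_congr rfl fun n _ => ?_
    rw [hconjpow _ (by rw [Complex.natCast_arg]; exact Real.pi_ne_zero.symm), map_natCast]
  rw [hsum]
  simp only [RiemannAux.conjFun]
  generalize ∑ k ∈ Finset.range (K + 1),
    (starRingEnd ℂ) (RiemannAux.D k ((starRingEnd ℂ) (RiemannAux.p s))) / η ^ k = S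
  rw [mul_neg, div_neg]
  ring_nf
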